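/- Let $\mathcal X_1,\mathcal X_2,\mathcal Q$ be finite sets, let $\mathcal H^B$ be a finite-dimensional Hilbert space, and let $(x_1,x_2)\mapsto\rho^B_{x_1,x_2}$ be a classical-quantum multiple access channel, that is, a density operator $\rho^B_{x_1,x_2}$ on $\mathcal H^B$ for each $(x_1,x_2)\in\mathcal X_1\times\mathcal X_2$. Let $p_Q$ be a probability distribution on $\mathcal Q$ and let $p_{X_1|Q}$, $p_{X_2|Q}$ be conditional probability distributions. Put $$\theta^{QX_1X_2B}=\sum_{q,x_1,x_2}p_Q(q)\,p_{X_1|Q}(x_1|q)\,p_{X_2|Q}(x_2|q)\,|q\rangle\langle q|\otimes|x_1\rangle\langle x_1|\otimes|x_2\rangle\langle x_2|\otimes\rho^B_{x_1,x_2},$$ and let $R_1,R_2$ be real numbers such that $$R_1\le I(X_1;B|X_2Q)_\theta,\qquad R_2\le I(X_2;B|X_1Q)_\theta,\qquad R_1+R_2\le I(X_1X_2;B|Q)_\theta,$$ where $I(A;B|C)=H(AC)+H(BC)-H(ABC)-H(C)$ and $H(\rho)=-\mathrm{Tr}(\rho\log_2\rho)$ is the von Neumann entropy. For given $n$, $M_1$,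 $M_2$ generate a random code as follows: draw $Q^n\sim\prod_{i=1}^n p_Q(q_i)$ and, conditionally on $Q^n=q^n$, draw independently codewords $X_1^n(m_1)\sim\prod_i p_{X_1|Q}(x_{1i}|q_i)$ for $1\le m_1\le M_1$ and $X_2^n(m_2)\sim\prod_i p_{X_2|Q}(x_{2i}|q_i)$ for $1\le m_2\le M_2$. Then for all $\epsilon,\delta>0$ and all sufficiently large $n$ the following holds for all message set sizes $1\le M_k\le\lceil 2^{n(R_k-\delta)}\rceil$ $(k=1,2)$. For every realization of the time-sharing sequence and of the two codebooks there is a simultaneous decoding POVM $\{\Lambda_{m_1,m_2}\}$ on $(\mathcal H^B)^{\otimes n}$ ($\Lambda_{m_1,m_2}\ge0$, $\sum_{m_1,m_2}\Lambda_{m_1,m_2}=I$) such that the expectation, over $Q^n$ and the two codebooks, of the average probability of error satisfies $$\mathbb E\left\{\frac1{M_1M_2}\sum_{m_1,m_2}\mathrm{Tr}\!\left[(I-\Lambda_{m_1,m_2})\,\rho_{X_1^n(m_1),X_2^n(m_2)}\right]\right\}\le\epsilon,$$ where $\rho_{x_1^n,x_2^n}=\bigotimes_{i=1}^n\rho^B_{x_{1i},x_{2i}}$.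 -/

import Mathlib

open scoped Matrix Kronecker ComplexOrder

noncomputable section

namespace QMAC

/-- A density matrix on the Hilbert space `ℂ^ι`: positive semidefinite with unit trace. -/
structure DensityMatrix (ι : Type*) [Fintype ι] where
  mat : Matrix ι ι ℂ
  posSemidef : mat.PosSemidef
  trace_eq_one : mat.trace = 1

namespace DensityMatrix

variable {ι κ τ : Type*} [Fintype ι] [Fintype κ] [Fintype τ]

/-- The von Neumann entropy `H(ρ) = -Tr(ρ log₂ ρ) = -∑ λ log₂ λ`, the sum running over the
eigenvalues of `ρ` with multiplicity (and `0 log₂ 0 = 0`). -/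
def entropy [DecidableEq ι] (ρ : DensityMatrix ι) : ℝ :=
  -∑ i, ρ.posSemidef.isHermitian.eigenvalues i *
    Real.logb 2 (ρ.posSemidef.isHermitian.eigenvalues i)

/-- Relabelling of the computational basis. It is used only to regroup tensor factors. -/
def reindex (e : ι ≃ κ) (ρ : DensityMatrix ι) : DensityMatrix κ where
  mat := ρ.mat.submatrix e.symm e.symm
  posSemidef := ρ.posSemidef.submatrix e.symm
  trace_eq_one := by
    rw [← ρ.trace_eq_one]
    exact Equiv.sum_comp e.symm (fun i => ρ.mat i i)

/-- The partial trace over the second tensor factor. -/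
def traceSnd (ρ : DensityMatrix (κ × τ)) : DensityMatrix κ where
  mat := ∑ t, ρ.mat.submatrix (fun a => (a, t)) (fun a => (a, t))
  posSemidef := Matrix.posSemidef_sum _ fun t _ => ρ.posSemidef.submatrix _
  trace_eq_one := by
    rw [← ρ.trace_eq_one, Matrix.trace_sum]
    exact (Fintype.sum_prod_type_right (fun i => ρ.mat i i)).symm

/-- The partial trace over the first tensor factor. -/
def traceFst (ρ : DensityMatrix (κ × τ)) : DensityMatrix τ :=
  (ρ.reindex (Equiv.prodComm κ τ)).traceSnd

end DensityMatrix

/-- The quantum conditional mutual information of a tripartite state on `A ⊗ B ⊗ C`,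
`I(A;B|C) = H(AC) + H(BC) - H(ABC) - H(C)`. -/
def condMutualInfo {α β γ : Type*} [Fintype α] [Fintype β] [Fintype γ]
    [DecidableEq α] [DecidableEq β] [DecidableEq γ] (θ : DensityMatrix (α × β × γ)) : ℝ :=
  let ρBC : DensityMatrix (β × γ) := θ.traceFst
  let ρC : DensityMatrix γ := ρBC.traceFst
  let ρAC : DensityMatrix (α × γ) :=
    (θ.reindex ⟨fun s => ((s.1, s.2.2), s.2.1), fun s => (s.1.1, s.2, s.1.2),
      fun _ => rfl, fun _ => rfl⟩ : DensityMatrix ((α × γ) × β)).traceSnd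
  ρAC.entropy + ρBC.entropy - θ.entropy - ρC.entropy

/-- The projector `|i⟩⟨i|` is positive semidefinite. -/
theorem posSemidef_single {ι : Type*} [DecidableEq ι] (i : ι) :
    (Matrix.single i i (1 : ℂ)).PosSemidef := by
  rw [← Matrix.diagonal_single]
  exact Matrix.PosSemidef.diagonal (Pi.single_nonneg.2 zero_le_one)

section Channel

variable {𝒬 X₁ X₂ B : Type*} [Fintype 𝒬] [Fintype X₁] [Fintype X₂] [Fintype B]

/-- The state `θ^{Q X₁ X₂ B} = ∑ p(q) p(x₁|q) p(x₂|q) |q⟩⟨q| ⊗ |x₁⟩⟨x₁| ⊗ |x₂⟩⟨x₂| ⊗ ρ_{x₁,x₂}`. -/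
def codeState [DecidableEq 𝒬] [DecidableEq X₁] [DecidableEq X₂]
    (ρ : X₁ → X₂ → DensityMatrix B) (pQ : stdSimplex ℝ 𝒬)
    (p₁ : 𝒬 → stdSimplex ℝ X₁) (p₂ : 𝒬 → stdSimplex ℝ X₂) :
    DensityMatrix (𝒬 × X₁ × X₂ × B) where
  mat := ∑ q, ∑ x₁, ∑ x₂, ((pQ q * p₁ q x₁ * p₂ q x₂ : ℝ) : ℂ) •
    (Matrix.single q q (1 : ℂ) ⊗ₖ (Matrix.single x₁ x₁ (1 : ℂ) ⊗ₖ
      (Matrix.single x₂ x₂ (1 : ℂ) ⊗ₖ (ρ x₁ x₂).mat)))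
  posSemidef := by
    refine Matrix.posSemidef_sum _ fun q _ => Matrix.posSemidef_sum _ fun x₁ _ =>
      Matrix.posSemidef_sum _ fun x₂ _ => ?_
    refine Matrix.PosSemidef.smul
      ((posSemidef_single q).kronecker ((posSemidef_single x₁).kronecker
        ((posSemidef_single x₂).kronecker (ρ x₁ x₂).posSemidef))) ?_
    have h : (0 : ℝ) ≤ pQ q * p₁ q x₁ * p₂ q x₂ :=
      mul_nonneg (mul_nonneg (pQ.2.1 q) ((p₁ q).2.1 x₁)) ((p₂ q).2.1 x₂)
    exact_mod_cast h
  trace_eq_one := by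
    have h : ∑ q, ∑ x₁, ∑ x₂, pQ q * p₁ q x₁ * p₂ q x₂ = (1 : ℝ) := by
      have h₂ : ∀ q, ∑ x₂, p₂ q x₂ = (1 : ℝ) := fun q => (p₂ q).2.2
      have h₁ : ∀ q, ∑ x₁, p₁ q x₁ = (1 : ℝ) := fun q => (p₁ q).2.2
      have h₀ : ∑ q, pQ q = (1 : ℝ) := pQ.2.2
      simp only [← Finset.mul_sum, h₂, h₁, h₀, mul_one]
    simp only [Matrix.trace_sum, Matrix.trace_smul, Matrix.trace_kronecker,
      Matrix.trace_single_eq_same, (ρ _ _).trace_eq_one, smul_eq_mul, mul_one]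
    exact_mod_cast h

/-- `I(X₁;B|X₂Q)_θ` for a state `θ` on `Q ⊗ X₁ ⊗ X₂ ⊗ B`. -/
def infoFirst [DecidableEq 𝒬] [DecidableEq X₁] [DecidableEq X₂] [DecidableEq B]
    (θ : DensityMatrix (𝒬 × X₁ × X₂ × B)) : ℝ :=
  condMutualInfo (θ.reindex ⟨fun s => (s.2.1, s.2.2.2, (s.2.2.1, s.1)),
    fun s => (s.2.2.2, s.1, s.2.2.1, s.2.1), fun _ => rfl, fun _ => rfl⟩ :
      DensityMatrix (X₁ × B × (X₂ × 𝒬)))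

/-- `I(X₂;B|X₁Q)_θ` for a state `θ` on `Q ⊗ X₁ ⊗ X₂ ⊗ B`. -/
def infoSecond [DecidableEq 𝒬] [DecidableEq X₁] [DecidableEq X₂] [DecidableEq B]
    (θ : DensityMatrix (𝒬 × X₁ × X₂ × B)) : ℝ :=
  condMutualInfo (θ.reindex ⟨fun s => (s.2.2.1, s.2.2.2, (s.2.1, s.1)),
    fun s => (s.2.2.2, s.2.2.1, s.1, s.2.1), fun _ => rfl, fun _ => rfl⟩ :
      DensityMatrix (X₂ × B × (X₁ × 𝒬)))

/-- `I(X₁X₂;B|Q)_θ` for a state `θ` on `Q ⊗ X₁ ⊗ X₂ ⊗ B`. -/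
def infoSum [DecidableEq 𝒬] [DecidableEq X₁] [DecidableEq X₂] [DecidableEq B]
    (θ : DensityMatrix (𝒬 × X₁ × X₂ × B)) : ℝ :=
  condMutualInfo (θ.reindex ⟨fun s => ((s.2.1, s.2.2.1), s.2.2.2, s.1),
    fun s => (s.2.2, s.1.1, s.1.2, s.2.1), fun _ => rfl, fun _ => rfl⟩ :
      DensityMatrix ((X₁ × X₂) × B × 𝒬))

/-- The output `ρ_{x₁ⁿ,x₂ⁿ} = ρ_{x₁₁,x₂₁} ⊗ ⋯ ⊗ ρ_{x₁ₙ,x₂ₙ}` of `n` uses of the channel, as a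
matrix on `(ℂ^B)^{⊗n} = ℂ^(Bⁿ)`. -/
def outputState (ρ : X₁ → X₂ → DensityMatrix B) {n : ℕ} (x₁ : Fin n → X₁) (x₂ : Fin n → X₂) :
    Matrix (Fin n → B) (Fin n → B) ℂ :=
  fun b b' => ∏ k, (ρ (x₁ k) (x₂ k)).mat (b k) (b' k)

/-- A positive operator-valued measure on `ℂ^ι` with outcomes in the finite set `O`. -/
structure POVM (ι O : Type*) [Fintype ι] [DecidableEq ι] [Fintype O] where
  op : O → Matrix ι ι ℂ
  posSemidef : ∀ o, (op o).PosSemidef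
  sum_eq_one : ∑ o, op o = 1

/-- The average probability of error
`(1 / (|M₁| |M₂|)) ∑_{m₁,m₂} Tr[(I - Λ_{m₁,m₂}) ρ_{x₁ⁿ(m₁),x₂ⁿ(m₂)}]`. -/
def avgError [DecidableEq B] (ρ : X₁ → X₂ → DensityMatrix B) {n M₁ M₂ : ℕ}
    (c₁ : Fin M₁ → Fin n → X₁) (c₂ : Fin M₂ → Fin n → X₂)
    (Λ : POVM (Fin n → B) (Fin M₁ × Fin M₂)) : ℝ :=
  (1 / ((M₁ : ℝ) * (M₂ : ℝ))) * ∑ m₁, ∑ m₂,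
    (((1 - Λ.op (m₁, m₂)) * outputState ρ (c₁ m₁) (c₂ m₂)).trace).re

/-- The probability `∏_m ∏_i p(x_i(m) | q_i)` of a codebook of `M` codewords that are drawn
independently according to `p^n(· | qⁿ)`, given the time-sharing sequence `qⁿ`. -/
def codebookProb {X : Type*} [Fintype X] (p : 𝒬 → stdSimplex ℝ X) {n M : ℕ}
    (q : Fin n → 𝒬) (c : Fin M → Fin n → X) : ℝ :=
  ∏ m, ∏ i, p (q i) (c m i)

/-- The expectation of the average probability of error over the i.i.d. time-sharing sequence
`Qⁿ` and the two codebooks, which are generated independently conditionally on `Qⁿ`. The decoder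
`Λ` may depend on the realizations of the time-sharing sequence and of the codebooks. -/
def expectedError [DecidableEq B] (ρ : X₁ → X₂ → DensityMatrix B) (pQ : stdSimplex ℝ 𝒬)
    (p₁ : 𝒬 → stdSimplex ℝ X₁) (p₂ : 𝒬 → stdSimplex ℝ X₂) {n M₁ M₂ : ℕ}
    (Λ : (Fin n → 𝒬) → (Fin M₁ → Fin n → X₁) → (Fin M₂ → Fin n → X₂) →
      POVM (Fin n → B) (Fin M₁ × Fin M₂)) : ℝ :=
  ∑ q : Fin n → 𝒬, (∏ i, pQ (q i)) *
    ∑ c₁ : Fin M₁ → Fin n → X₁, ∑ c₂ : Fin M₂ → Fin n → X₂,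
      codebookProb p₁ q c₁ * codebookProb p₂ q c₂ * avgError ρ c₁ c₂ (Λ q c₁ c₂)

end Channel

end QMAC

end

open scoped Matrix Kronecker ComplexOrder

noncomputable section

set_option linter.unusedSectionVars false

/-! ### Operator inequalities for projections and the square-root measurement. -/

section OperatorInequalities

open scoped MatrixOrder Matrix.Norms.L2Operator

variable {ι : Type*} [Fintype ι] [DecidableEq ι]

/-! Fix the time-sharing sequence. Let `P₀`, `Q₁ x`, `Q₂ y` cut off the large eigenvalues of the
product output averaged over both inputs, over the second input given `x`, and over the first input
given `y`. Let `T x y` keep the large eigenvalues of the output for `(x, y)`. A projection of the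
first kind bounds an averaged state by `L • 1`, with `L` about `2^(-nH)` for the matching
conditional entropy; the last kind satisfies `T ≤ K • ρ`, with `K` about `2^(nH(B|X₁X₂Q))`.

The natural test would sandwich `T` between all three cut-offs, but these do not commute, and no
ordering makes every averaged state meet its own cut-off. The way out is to treat the two senders
differently. The decoder is the square-root measurement built from `P₀ Q₁ T Q₁ P₀` alone; `Q₂` never
enters it and only smooths the transmitted state in the analysis, `ρ ↦ Q₂ ρ Q₂`, by pinching
(`expect_error_le`).

The Hayashi-Nagaoka inequality (`exists_hayashi_nagaoka`) then leaves three kinds of wrong message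
pair. If only the first message is wrong, averaging the state over `x` exposes it to `Q₂`, giving `K
* L₂` (`average_first_le`). If only the second is wrong, averaging the test over `y'` exposes it to
`Q₁`, giving `K * L₁` (`average_second_le`). If both are wrong, `Q₂` can be dropped because it
commutes with the state it was cut from, and `P₀` gives `K * L₀` (`average_both_le`). Each constant
is about `2^(-nI)` for the mutual information bounding the corresponding rate or rate sum, so the
exponential number of competitors is beaten.

The remaining error is the probability that a state fails its own test. Pairing inputs with
eigenvalue labels gives an i.i.d. sequence, and Chebyshev's inequality for the log-eigenvalues makes
this error small (`exists_sum_atypical_le`). For classical-quantum states the Shannon terms cancel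
in the mutual informations, which become differences of precisely these average entropies
(`condMutualInfo_of_classical`). -/

/-- A positive contraction dominates its square. -/
theorem mul_self_le_self_of_nonneg_of_le_one {S : Matrix ι ι ℂ} (h0 : 0 ≤ S) (h1 : S ≤ 1) :
    S * S ≤ S := by
  have hS : IsSelfAdjoint S := IsSelfAdjoint.of_nonneg h0
  have hS' : IsSelfAdjoint (1 - S) := (IsSelfAdjoint.one _).sub hS
  have a := IsSelfAdjoint.conjugate_nonneg (sub_nonneg.2 h1) hS
  have b := IsSelfAdjoint.conjugate_nonneg h0 hS'
  have := add_nonneg a b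
  rw [← sub_nonneg]
  convert this using 1
  noncomm_ring

/-- The Hayashi-Nagaoka inequality, for the square-root measurement of an invertible total
operator `W`. -/
theorem exists_hayashi_nagaoka {W : Matrix ι ι ℂ} (hW : W.PosDef) :
    ∃ X : Matrix ι ι ℂ, IsSelfAdjoint X ∧ X * W * X = 1 ∧
      ∀ S : Matrix ι ι ℂ, 0 ≤ S → S ≤ 1 → S ≤ W →
        1 - X * S * X ≤ 2 • (1 - S) + 4 • (W - S) := by
  have hW0 : 0 ≤ W := hW.posSemidef.nonneg
  set Y := CFC.sqrt W with hY
  have hYY : Y * Y = W := CFC.sqrt_mul_sqrt_self W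
  have hY0 : 0 ≤ Y := CFC.sqrt_nonneg W
  have hYu : IsUnit Y.det := by
    have : IsUnit (Y * Y).det := by
      rw [hYY]; exact (Matrix.isUnit_iff_isUnit_det _).1 hW.isUnit
    rw [Matrix.det_mul] at this
    exact isUnit_of_mul_isUnit_left this
  have hX1 : Y⁻¹ * Y = 1 := Matrix.nonsing_inv_mul _ hYu
  have hX2 : Y * Y⁻¹ = 1 := Matrix.mul_nonsing_inv _ hYu
  have hX : IsSelfAdjoint Y⁻¹ := (Matrix.nonneg_iff_posSemidef.1 hY0).inv.isHermitian
  generalize Y⁻¹ = X at *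
  have hXWX : X * W * X = 1 := by
    rw [← hYY]
    calc X * (Y * Y) * X = (X * Y) * (Y * X) := by noncomm_ring
      _ = 1 := by rw [hX1, hX2, one_mul]
  refine ⟨X, hX, hXWX, fun S hS0 hS1 hSW => ?_⟩
  have hXW : X * W = Y := by rw [← hYY, ← mul_assoc, hX1, one_mul]
  have hWX : W * X = Y := by rw [← hYY, mul_assoc, hX2, mul_one]
  -- `S² ≤ S ≤ W`, and the square root is operator monotone.
  have hSY : S ≤ Y := by
    have := CFC.sqrt_le_sqrt (S * S) W ((mul_self_le_self_of_nonneg_of_le_one hS0 hS1).trans hSW)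
    rwa [CFC.sqrt_mul_self S] at this
  have a : 0 ≤ (X - 2) * (W - S) * (X - 2) :=
    IsSelfAdjoint.conjugate_nonneg (sub_nonneg.2 hSW) (hX.sub (IsSelfAdjoint.ofNat 2))
  have b : 0 ≤ (X - 1) * S * (X - 1) :=
    IsSelfAdjoint.conjugate_nonneg hS0 (hX.sub (IsSelfAdjoint.one _))
  -- With `XW = WX = Y` and `XWX = 1`, this sum of positive terms is exactly the gap in the claimed
  -- inequality; the terms `4 • Y` cancel.
  have c : 0 ≤ (X - 2) * (W - S) * (X - 2) + 2 • ((X - 1) * S * (X - 1)) + 4 • (Y - S) :=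
    add_nonneg (add_nonneg a (nsmul_nonneg b _)) (nsmul_nonneg (sub_nonneg.2 hSY) _)
  rw [← sub_nonneg]
  refine c.trans_eq ?_
  have e1 : (X - 2) * (W - S) * (X - 2) = X * W * X - X * S * X - 2 • (X * W) - 2 • (W * X)
      + 2 • (X * S) + 2 • (S * X) + 4 • W - 4 • S := by noncomm_ring
  have e2 : (X - 1) * S * (X - 1) = X * S * X - X * S - S * X + S := by noncomm_ring
  rw [e1, e2, hXWX, hXW, hWX]
  noncomm_ring

variable {P E F : Matrix ι ι ℂ}

theorem _root_.IsIdempotentElem.conj_one_sub (hP : IsIdempotentElem P) :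
    P * (1 - E) * P = P - P * E * P := by
  rw [mul_sub, mul_one, sub_mul, hP.eq]

/-- With `Q = 1 - P`, positivity of `(P - Q)E(P - Q)` bounds the off-diagonal blocks by the diagonal
ones, and `QEQ ≤ Q`. -/
theorem pinching_bound (hP : IsStarProjection P) (hE0 : 0 ≤ E) (hE1 : E ≤ 1) :
    E ≤ 2 • (P * E * P) + 2 • (1 - P) := by
  have hP1 : IsSelfAdjoint (1 - P) := hP.one_sub.isSelfAdjoint
  have hP2 : IsSelfAdjoint (P - (1 - P)) := hP.isSelfAdjoint.sub hP1
  have a := IsSelfAdjoint.conjugate_nonneg hE0 hP2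
  have b := IsSelfAdjoint.conjugate_nonneg (sub_nonneg.2 hE1) hP1
  rw [hP.one_sub.isIdempotentElem.conj_one_sub] at b
  have := add_nonneg a (nsmul_nonneg b 2)
  rw [← sub_nonneg]
  convert this using 1
  noncomm_ring

/-- With `Q = 1 - P`, the parallelogram identity `(1 - Q)E(1 - Q) + (1 + Q)E(1 + Q) = 2E + 2QEQ`,
together with `QEQ ≤ Q`. It plays the role of the gentle measurement lemma, but is linear in the
error. -/
theorem conj_le_two_nsmul_add (hP : IsStarProjection P) (hE0 : 0 ≤ E) (hE1 : E ≤ 1) :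
    P * E * P ≤ 2 • E + 2 • (1 - P) := by
  have hP1 : IsSelfAdjoint (1 - P) := hP.one_sub.isSelfAdjoint
  have hP2 : IsSelfAdjoint (1 + (1 - P)) := (IsSelfAdjoint.one _).add hP1
  have a := IsSelfAdjoint.conjugate_nonneg hE0 hP2
  have b := IsSelfAdjoint.conjugate_nonneg (sub_nonneg.2 hE1) hP1
  rw [hP.one_sub.isIdempotentElem.conj_one_sub] at b
  have := add_nonneg a (nsmul_nonneg b 2)
  rw [← sub_nonneg]
  convert this using 1
  noncomm_ring

theorem one_sub_conj_le (hP : IsStarProjection P) (hF0 : 0 ≤ F) (hF1 : F ≤ 1) :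
    1 - P * F * P ≤ 3 • (1 - P) + 2 • (1 - F) := by
  have := conj_le_two_nsmul_add hP (sub_nonneg.2 hF1) (sub_le_self 1 hF0)
  rw [← sub_nonneg] at this ⊢
  convert this using 1
  rw [hP.isIdempotentElem.conj_one_sub]
  noncomm_ring

theorem conj_le_one (hP : IsStarProjection P) (hF1 : F ≤ 1) : P * F * P ≤ 1 := by
  have := hP.isSelfAdjoint.conjugate_le_conjugate hF1
  rw [mul_one, hP.isIdempotentElem] at this
  exact this.trans hP.le_one

/-- The real linear functional `A ↦ Re Tr (A ρ)`. -/
def expect (ρ : Matrix ι ι ℂ) : Matrix ι ι ℂ →ₗ[ℝ] ℝ :=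
  Complex.reLm ∘ₗ (Matrix.traceLinearMap ι ℝ ℂ) ∘ₗ (LinearMap.mulRight ℝ ρ)

theorem expect_apply (ρ A : Matrix ι ι ℂ) : expect ρ A = (A * ρ).trace.re := rfl

theorem expect_comm (ρ A : Matrix ι ι ℂ) : expect ρ A = expect A ρ := by
  rw [expect_apply, expect_apply, Matrix.trace_mul_comm]

theorem trace_mul_nonneg {A ρ : Matrix ι ι ℂ} (hA : 0 ≤ A) (hρ : 0 ≤ ρ) : 0 ≤ expect ρ A := by
  have h : A = CFC.sqrt A * CFC.sqrt A := (CFC.sqrt_mul_sqrt_self A).symm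
  rw [expect_apply, h, mul_assoc, Matrix.trace_mul_comm]
  have hs : IsSelfAdjoint (CFC.sqrt A) := IsSelfAdjoint.of_nonneg (CFC.sqrt_nonneg A)
  have := (Matrix.nonneg_iff_posSemidef.1 (IsSelfAdjoint.conjugate_nonneg hρ hs)).trace_nonneg
  exact (Complex.le_def.1 this).1

theorem expect_mono {A A' ρ : Matrix ι ι ℂ} (hA : A ≤ A') (hρ : 0 ≤ ρ) :
    expect ρ A ≤ expect ρ A' := by
  rw [← sub_nonneg, ← map_sub]
  exact trace_mul_nonneg (sub_nonneg.2 hA) hρ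

theorem expect_state_mono {A ρ ρ' : Matrix ι ι ℂ} (hA : 0 ≤ A) (hρ : ρ ≤ ρ') :
    expect ρ A ≤ expect ρ' A := by
  rw [expect_comm ρ, expect_comm ρ']
  exact expect_mono hρ hA

theorem expect_conj (ρ A P : Matrix ι ι ℂ) : expect (P * ρ * P) A = expect ρ (P * A * P) := by
  rw [expect_apply, expect_apply, show A * (P * ρ * P) = (A * P * ρ) * P by noncomm_ring,
    Matrix.trace_mul_comm]
  congr 2
  noncomm_ring

theorem expect_one (ρ : Matrix ι ι ℂ) : expect ρ 1 = ρ.trace.re := by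
  rw [expect_apply, one_mul]

end OperatorInequalities

/-! ### Averages over independent codewords. -/

section RandomCodebook

variable {X : Type*} [Fintype X] {M : ℕ} {p : X → ℝ}

theorem sum_codebook_prod (g : Fin M → X → ℝ) :
    ∑ c : Fin M → X, ∏ m, g m (c m) = ∏ m, ∑ x, g m x := by
  classical
  rw [Finset.prod_univ_sum, Fintype.piFinset_univ]

theorem sum_codebook_eval_mul_eval (hp : ∑ x, p x = 1) {a b : Fin M} (hab : a ≠ b)
    (f g : X → ℝ) :
    ∑ c : Fin M → X, (∏ m, p (c m)) * (f (c a) * g (c b)) =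
      (∑ x, p x * f x) * ∑ x, p x * g x := by
  classical
  have h := sum_codebook_prod (M := M)
    (fun m x => p x * ((if m = a then f x else 1) * if m = b then g x else 1))
  have e : ∀ c : Fin M → X, (∏ m, p (c m)) * (f (c a) * g (c b)) =
      ∏ m, (p (c m) * ((if m = a then f (c m) else 1) * if m = b then g (c m) else 1)) := by
    intro c
    rw [Finset.prod_mul_distrib, Finset.prod_mul_distrib, Finset.prod_ite_eq' _ a,
      Finset.prod_ite_eq' _ b]
    simp
  simp_rw [e]
  rw [h, ← Finset.mul_prod_erase _ _ (Finset.mem_univ a),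
    ← Finset.mul_prod_erase _ _ (Finset.mem_erase.2 ⟨hab.symm, Finset.mem_univ b⟩),
    Finset.prod_eq_one, mul_one]
  · simp [hab, hab.symm]
  · intro m hm
    simp only [Finset.mem_erase, Finset.mem_univ, and_true] at hm
    simp [hm.1, hm.2, hp]

/-- Pairwise independence of distinct codewords: conditioning on the value at `a` by indicators
reduces to a product of one-variable functions. -/
theorem sum_codebook_eval₂ (hp : ∑ x, p x = 1) {a b : Fin M} (hab : a ≠ b) (f : X → X → ℝ) :
    ∑ c : Fin M → X, (∏ m, p (c m)) * f (c a) (c b) =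
      ∑ x, ∑ x', p x * p x' * f x x' := by
  classical
  have e : ∀ c : Fin M → X, (∏ m, p (c m)) * f (c a) (c b) =
      ∑ x, (∏ m, p (c m)) * ((if c a = x then 1 else 0) * f x (c b)) := by
    intro c
    rw [← Finset.mul_sum]
    simp
  simp_rw [e]
  rw [Finset.sum_comm]
  refine Finset.sum_congr rfl fun x _ => ?_
  rw [sum_codebook_eval_mul_eval hp hab (fun y => if y = x then 1 else 0) (f x)]
  simp [Finset.mul_sum, mul_assoc]

theorem sum_codebook_eval (hp : ∑ x, p x = 1) (a : Fin M) (f : X → ℝ) :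
    ∑ c : Fin M → X, (∏ m, p (c m)) * f (c a) = ∑ x, p x * f x := by
  classical
  have h := sum_codebook_prod (M := M) (fun m x => p x * if m = a then f x else 1)
  have e : ∀ c : Fin M → X, (∏ m, p (c m)) * f (c a) =
      ∏ m, (p (c m) * if m = a then f (c m) else 1) := by
    intro c
    rw [Finset.prod_mul_distrib, Finset.prod_ite_eq' _ a]
    simp
  simp_rw [e]
  rw [h, ← Finset.mul_prod_erase _ _ (Finset.mem_univ a), Finset.prod_eq_one, mul_one]
  · simp
  · intro m hm
    simp only [Finset.mem_erase, Finset.mem_univ, and_true] at hm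
    simp [hm, hp]

end RandomCodebook

/-! ### The measurement, and the three kinds of wrong message pair. -/

section OneShot

open scoped MatrixOrder Matrix.Norms.L2Operator

variable {ι : Type*} [Fintype ι] [DecidableEq ι]

theorem posSemidef_smul_one {η : ℝ} (hη : 0 ≤ η) : (0 : Matrix ι ι ℂ) ≤ η • 1 :=
  Matrix.nonneg_iff_posSemidef.2 (Matrix.PosSemidef.one.smul hη)

/-- A square-root measurement whose errors obey the Hayashi-Nagaoka bound, up to a regularization
`η`. -/
theorem exists_povm {O : Type*} [Fintype O] [DecidableEq O] (o₀ : O) (S : O → Matrix ι ι ℂ)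
    (hS0 : ∀ o, 0 ≤ S o) (hS1 : ∀ o, S o ≤ 1) {η : ℝ} (hη : 0 < η) :
    ∃ Λ : QMAC.POVM ι O, ∀ o,
      1 - Λ.op o ≤ 2 • (1 - S o) + 4 • (∑ o' ∈ Finset.univ.erase o, S o' + η • 1) := by
  have hR0 : (0 : Matrix ι ι ℂ) ≤ η • 1 := posSemidef_smul_one hη.le
  have hR1 : (η • 1 : Matrix ι ι ℂ).PosDef := Matrix.PosDef.one.smul hη
  generalize (η • 1 : Matrix ι ι ℂ) = R at *
  obtain ⟨W, hW⟩ : ∃ W : Matrix ι ι ℂ, W = ∑ o, S o + R := ⟨_, rfl⟩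
  have hsum : 0 ≤ ∑ o, S o := Finset.sum_nonneg fun o _ => hS0 o
  have hWp : W.PosDef := by
    rw [hW]
    exact hR1.posSemidef_add (Matrix.nonneg_iff_posSemidef.1 hsum)
  obtain ⟨X, hX, hXWX, hN⟩ := exists_hayashi_nagaoka hWp
  have hL : 0 ≤ X * R * X :=
    IsSelfAdjoint.conjugate_nonneg hR0 hX
  -- The regularizer keeps the total operator invertible; its share of the identity is handed to the
  -- outcome `o₀`, which can only lower that outcome's error.
  set L : Matrix ι ι ℂ := X * R * X with hLd
  have hL' : ∀ o, 0 ≤ if o = o₀ then L else 0 := by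
    intro o
    split_ifs
    exacts [hL, le_rfl]
  have hsum1 : ∑ o, (X * S o * X + if o = o₀ then L else 0) = 1 := by
    rw [Finset.sum_add_distrib, Finset.sum_ite_eq' _ o₀, if_pos (Finset.mem_univ _),
      ← Finset.sum_mul, ← Finset.mul_sum, hLd, ← add_mul, ← mul_add, ← hW, hXWX]
  refine ⟨⟨fun o => X * S o * X + if o = o₀ then L else 0, fun o =>
    Matrix.nonneg_iff_posSemidef.1
      (add_nonneg (IsSelfAdjoint.conjugate_nonneg (hS0 o) hX) (hL' o)), hsum1⟩, fun o => ?_⟩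
  have hSW : W - S o = ∑ o' ∈ Finset.univ.erase o, S o' + R := by
    rw [hW, ← Finset.add_sum_erase _ _ (Finset.mem_univ o)]
    abel
  have hle : S o ≤ W := by
    rw [← sub_nonneg, hSW]
    exact add_nonneg (Finset.sum_nonneg fun o _ => hS0 o) hR0
  rw [← hSW]
  exact (sub_le_sub_left (le_add_of_nonneg_right (hL' o)) _).trans (hN (S o) (hS0 o) (hS1 o) hle)

theorem QMAC.POVM.op_le_one {O : Type*} [Fintype O] (Λ : QMAC.POVM ι O) (o : O) :
    Λ.op o ≤ 1 := by
  rw [← Λ.sum_eq_one]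
  exact Finset.single_le_sum (f := Λ.op)
    (fun o _ => Matrix.nonneg_iff_posSemidef.2 (Λ.posSemidef o)) (Finset.mem_univ o)

/-- The sandwiched test operator `P₀ P₁ F P₁ P₀`. -/
def sandwich (P₀ P₁ F : Matrix ι ι ℂ) : Matrix ι ι ℂ := P₀ * (P₁ * F * P₁) * P₀

variable {P₀ P₁ P₂ F : Matrix ι ι ℂ}

theorem sandwich_nonneg (h₀ : IsStarProjection P₀) (h₁ : IsStarProjection P₁) (hF : 0 ≤ F) :
    0 ≤ sandwich P₀ P₁ F :=
  IsSelfAdjoint.conjugate_nonneg (IsSelfAdjoint.conjugate_nonneg hF h₁.isSelfAdjoint)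
    h₀.isSelfAdjoint

theorem sandwich_le_one (h₀ : IsStarProjection P₀) (h₁ : IsStarProjection P₁) (hF : F ≤ 1) :
    sandwich P₀ P₁ F ≤ 1 :=
  conj_le_one h₀ (conj_le_one h₁ hF)

theorem one_sub_sandwich_le (h₀ : IsStarProjection P₀) (h₁ : IsStarProjection P₁)
    (hF0 : 0 ≤ F) (hF1 : F ≤ 1) :
    1 - sandwich P₀ P₁ F ≤ 3 • (1 - P₀) + 2 • (3 • (1 - P₁) + 2 • (1 - F)) :=
  (one_sub_conj_le h₀ (IsSelfAdjoint.conjugate_nonneg hF0 h₁.isSelfAdjoint)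
    (conj_le_one h₁ hF1)).trans
    (add_le_add_right (nsmul_le_nsmul_right (one_sub_conj_le h₁ hF0 hF1) 2) _)

/-- Error of a square-root measurement on a state that is smoothed, in the analysis only, by a
projection `P₂`. -/
theorem expect_error_le {O : Type*} [Fintype O] [DecidableEq O] {S : O → Matrix ι ι ℂ} {η : ℝ}
    {Λ : QMAC.POVM ι O} {o : O}
    (hΛ : 1 - Λ.op o ≤ 2 • (1 - S o) + 4 • (∑ o' ∈ Finset.univ.erase o, S o' + η • 1))
    (hη : 0 ≤ η)
    (h₀ : IsStarProjection P₀) (h₁ : IsStarProjection P₁) (h₂ : IsStarProjection P₂)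
    (hF0 : 0 ≤ F) (hF1 : F ≤ 1) (hS : S o = sandwich P₀ P₁ F)
    {ρ : Matrix ι ι ℂ} (hρ : 0 ≤ ρ) (hρ1 : ρ.trace = 1) :
    expect ρ (1 - Λ.op o) ≤
      48 * (expect ρ (1 - P₀) + expect ρ (1 - P₁) + expect ρ (1 - P₂) + expect ρ (1 - F)) +
      8 * (∑ o' ∈ Finset.univ.erase o, expect (P₂ * ρ * P₂) (S o')) + 8 * η := by
  have hρ' : 0 ≤ P₂ * ρ * P₂ := IsSelfAdjoint.conjugate_nonneg hρ h₂.isSelfAdjoint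
  have hΛ0 : 0 ≤ Λ.op o := Matrix.nonneg_iff_posSemidef.2 (Λ.posSemidef o)
  have a := expect_mono (pinching_bound h₂ (sub_nonneg.2 (Λ.op_le_one o))
    (sub_le_self 1 hΛ0)) hρ
  have b := expect_mono hΛ hρ'
  have c := expect_mono (conj_le_two_nsmul_add h₂
    (sub_nonneg.2 (sandwich_le_one h₀ h₁ hF1))
    (sub_le_self 1 (sandwich_nonneg h₀ h₁ hF0))) hρ
  have d := expect_mono (one_sub_sandwich_le h₀ h₁ hF0 hF1) hρ
  have t : expect (P₂ * ρ * P₂) 1 ≤ 1 := by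
    rw [expect_conj, mul_one, h₂.isIdempotentElem]
    refine (expect_mono h₂.le_one hρ).trans ?_
    rw [expect_one, hρ1, Complex.one_re]
  rw [hS] at b
  have e0 := trace_mul_nonneg (sub_nonneg.2 h₀.le_one) hρ
  have e1 := trace_mul_nonneg (sub_nonneg.2 h₁.le_one) hρ
  have e2 := trace_mul_nonneg (sub_nonneg.2 h₂.le_one) hρ
  have e3 := trace_mul_nonneg (sub_nonneg.2 hF1) hρ
  simp only [map_add, map_nsmul, map_smul, map_sum, ← expect_conj] at a b c d
  simp only [nsmul_eq_mul, smul_eq_mul, Nat.cast_ofNat] at a b c d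
  -- Chaining `a`-`d` gives weights 24, 48, 10 and 32 on the four test errors; 48 bounds them all.
  have t' : η * expect (P₂ * ρ * P₂) 1 ≤ η := mul_le_of_le_one_right hη t
  linarith

/-- `P₂` is quantified after the measurement: the smoothing may depend on the transmitted message
although the decoder does not know it. -/
theorem exists_povm_expect_error_le {O : Type*} [Fintype O] [DecidableEq O] (o₀ : O)
    (P₀ : Matrix ι ι ℂ) (P₁ T : O → Matrix ι ι ℂ) (h₀ : IsStarProjection P₀)
    (h₁ : ∀ o, IsStarProjection (P₁ o)) (hT0 : ∀ o, 0 ≤ T o) (hT1 : ∀ o, T o ≤ 1)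
    {η : ℝ} (hη : 0 < η) :
    ∃ Λ : QMAC.POVM ι O, ∀ o (P₂ ρ : Matrix ι ι ℂ), IsStarProjection P₂ → 0 ≤ ρ →
      ρ.trace = 1 → expect ρ (1 - Λ.op o) ≤
        48 * (expect ρ (1 - P₀) + expect ρ (1 - P₁ o) + expect ρ (1 - P₂) +
          expect ρ (1 - T o)) +
        8 * (∑ o' ∈ Finset.univ.erase o,
          expect (P₂ * ρ * P₂) (sandwich P₀ (P₁ o') (T o'))) + 8 * η := by
  obtain ⟨S, hS⟩ : ∃ S : O → Matrix ι ι ℂ, ∀ o, S o = sandwich P₀ (P₁ o) (T o) :=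
    ⟨_, fun _ => rfl⟩
  have h := exists_povm o₀ S (fun o => (sandwich_nonneg h₀ (h₁ o) (hT0 o)).trans_eq (hS o).symm)
    (fun o => (hS o).trans_le (sandwich_le_one h₀ (h₁ o) (hT1 o))) hη
  refine h.imp fun Λ hΛ o P₂ ρ h₂ hρ hρ1 => ?_
  have := expect_error_le (hΛ o) hη.le h₀ (h₁ o) h₂ (hT0 o) (hT1 o) (hS o) hρ hρ1
  simpa only [hS] using this

variable {X Y : Type*} [Fintype X] [Fintype Y]

section Averages

variable {p : X → ℝ} {r : Y → ℝ} {ρ : X → Y → Matrix ι ι ℂ}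
  {Q₁ : X → Matrix ι ι ℂ} {Q₂ : Y → Matrix ι ι ℂ} {T : X → Y → Matrix ι ι ℂ}
  {K L₀ L₁ L₂ : ℝ}

theorem smul_nonneg_matrix {c : ℝ} (hc : 0 ≤ c) {A : Matrix ι ι ℂ} (hA : 0 ≤ A) : 0 ≤ c • A :=
  Matrix.nonneg_iff_posSemidef.2 ((Matrix.nonneg_iff_posSemidef.1 hA).smul hc)

theorem smul_le_smul_matrix {c : ℝ} (hc : 0 ≤ c) {A A' : Matrix ι ι ℂ} (hA : A ≤ A') :
    c • A ≤ c • A' := by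
  rw [← sub_nonneg, ← smul_sub]
  exact smul_nonneg_matrix hc (sub_nonneg.2 hA)

theorem conj_smul_sum {α : Type*} [Fintype α] (w : α → ℝ) (A : α → Matrix ι ι ℂ)
    (P : Matrix ι ι ℂ) : ∑ x, w x • (P * A x * P) = P * (∑ x, w x • A x) * P := by
  simp [Finset.mul_sum, Finset.sum_mul]

theorem expect_smul_sum {α : Type*} [Fintype α] (w : α → ℝ) (A : α → Matrix ι ι ℂ)
    (E : Matrix ι ι ℂ) : ∑ x, w x * expect (A x) E = expect (∑ x, w x • A x) E := by
  simp only [fun x => expect_comm (A x) E]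
  rw [expect_comm, map_sum]
  simp

theorem expect_sum_smul {α : Type*} [Fintype α] (w : α → ℝ) (A : α → Matrix ι ι ℂ)
    (E : Matrix ι ι ℂ) : ∑ x, w x * expect E (A x) = expect E (∑ x, w x • A x) := by
  rw [map_sum]
  simp

theorem expect_le_of_le_smul_one {σ E : Matrix ι ι ℂ} {L : ℝ} (hE : 0 ≤ E) (h : σ ≤ L • 1) :
    expect σ E ≤ L * E.trace.re := by
  refine (expect_state_mono hE h).trans_eq ?_
  rw [expect_comm, map_smul, smul_eq_mul, expect_one]

theorem trace_conj_le {P A : Matrix ι ι ℂ} (hP : IsStarProjection P) (hA : 0 ≤ A) :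
    (P * A * P).trace.re ≤ A.trace.re := by
  rw [← expect_one, expect_conj, mul_one, hP.isIdempotentElem, ← expect_one]
  exact expect_mono hP.le_one hA

/-- Compression by a projection does not increase the trace of a positive operator, so `K` bounds
the effective rank of a test. -/
theorem trace_sandwich_le (h₀ : IsStarProjection P₀) (h₁ : IsStarProjection P₁) (hF0 : 0 ≤ F)
    {σ : Matrix ι ι ℂ} (hσ1 : σ.trace = 1) (hF : F ≤ K • σ) :
    (sandwich P₀ P₁ F).trace.re ≤ K := by
  refine (trace_conj_le h₀ (IsSelfAdjoint.conjugate_nonneg hF0 h₁.isSelfAdjoint)).trans ?_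
  refine (trace_conj_le h₁ hF0).trans ?_
  have := expect_state_mono (Matrix.nonneg_iff_posSemidef.2 Matrix.PosSemidef.one) hF
  rw [expect_one, expect_one, Matrix.trace_smul, hσ1] at this
  simpa using this

/-- Wrong first message, right second message. -/
theorem average_first_le (hr0 : ∀ y, 0 ≤ r y) (hr1 : ∑ y, r y = 1)
    (hp0 : ∀ x, 0 ≤ p x) (hp1 : ∑ x, p x = 1)
    (h₀ : IsStarProjection P₀) (h₁ : ∀ x, IsStarProjection (Q₁ x))
    (hT0 : ∀ x y, 0 ≤ T x y) (hρ1 : ∀ x y, (ρ x y).trace = 1)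
    (hK : ∀ x y, T x y ≤ K • ρ x y) (hL0 : 0 ≤ L₂)
    (hL : ∀ y, Q₂ y * (∑ x, p x • ρ x y) * Q₂ y ≤ L₂ • 1) :
    ∑ y, r y * ∑ x, ∑ x', p x * p x' *
      expect (Q₂ y * ρ x y * Q₂ y) (sandwich P₀ (Q₁ x') (T x' y)) ≤ K * L₂ := by
  have key : ∀ y x', ∑ x, p x *
      expect (Q₂ y * ρ x y * Q₂ y) (sandwich P₀ (Q₁ x') (T x' y)) ≤ K * L₂ := by
    intro y x'
    -- The wrong codeword `x'` is independent of `x`, so the test is constant while the state is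
    -- averaged over `x`; the averaged state is what `Q₂ y` flattens.
    rw [expect_smul_sum, conj_smul_sum, mul_comm]
    refine (expect_le_of_le_smul_one (sandwich_nonneg h₀ (h₁ x') (hT0 x' y)) (hL y)).trans ?_
    exact mul_le_mul_of_nonneg_left
      (trace_sandwich_le h₀ (h₁ x') (hT0 x' y) (hρ1 x' y) (hK x' y)) hL0
  calc _ = ∑ y, r y * ∑ x', p x' * ∑ x, p x *
        expect (Q₂ y * ρ x y * Q₂ y) (sandwich P₀ (Q₁ x') (T x' y)) := by
        refine Finset.sum_congr rfl fun y _ => ?_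
        rw [Finset.sum_comm]
        simp only [Finset.mul_sum]
        refine Finset.sum_congr rfl fun x' _ => Finset.sum_congr rfl fun x _ => by ring
    _ ≤ ∑ y, r y * ∑ x', p x' * (K * L₂) := by
        gcongr with y _ x' _
        · exact hr0 y
        · exact hp0 x'
        · exact key y x'
    _ = K * L₂ := by simp only [← Finset.sum_mul, hp1, hr1, one_mul]

theorem sandwich_le {σ : Matrix ι ι ℂ} (h₀ : IsStarProjection P₀) (h₁ : IsStarProjection P₁)
    (hK0 : 0 ≤ K) (hL0 : 0 ≤ L₁) (hF : F ≤ K • σ) (hL : P₁ * σ * P₁ ≤ L₁ • 1) :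
    sandwich P₀ P₁ F ≤ (K * L₁) • 1 := by
  have a := IsSelfAdjoint.conjugate_le_conjugate hF h₁.isSelfAdjoint
  have b : P₁ * F * P₁ ≤ (K * L₁) • 1 := by
    refine a.trans ?_
    rw [mul_smul_comm, smul_mul_assoc, mul_smul]
    exact smul_le_smul_matrix hK0 hL
  have c := IsSelfAdjoint.conjugate_le_conjugate b h₀.isSelfAdjoint
  refine c.trans ?_
  rw [mul_smul_comm, smul_mul_assoc, mul_one, h₀.isIdempotentElem]
  exact smul_le_smul_matrix (mul_nonneg hK0 hL0) h₀.le_one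

theorem sandwich_smul_sum {α : Type*} [Fintype α] (w : α → ℝ) (A : α → Matrix ι ι ℂ) :
    ∑ y, w y • sandwich P₀ P₁ (A y) = sandwich P₀ P₁ (∑ y, w y • A y) := by
  simp only [sandwich]
  rw [conj_smul_sum w (fun y => P₁ * A y * P₁), conj_smul_sum]

/-- Right first message, wrong second message. -/
theorem average_second_le (hr0 : ∀ y, 0 ≤ r y) (hr1 : ∑ y, r y = 1)
    (hp0 : ∀ x, 0 ≤ p x) (hp1 : ∑ x, p x = 1)
    (h₀ : IsStarProjection P₀) (h₁ : ∀ x, IsStarProjection (Q₁ x))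
    (h₂ : ∀ y, IsStarProjection (Q₂ y))
    (hρ0 : ∀ x y, 0 ≤ ρ x y) (hρ1 : ∀ x y, (ρ x y).trace = 1)
    (hK0 : 0 ≤ K) (hK : ∀ x y, T x y ≤ K • ρ x y) (hL0 : 0 ≤ L₁)
    (hL : ∀ x, Q₁ x * (∑ y, r y • ρ x y) * Q₁ x ≤ L₁ • 1) :
    ∑ x, p x * ∑ y, ∑ y', r y * r y' *
      expect (Q₂ y * ρ x y * Q₂ y) (sandwich P₀ (Q₁ x) (T x y')) ≤ K * L₁ := by
  have key : ∀ x y, ∑ y', r y' *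
      expect (Q₂ y * ρ x y * Q₂ y) (sandwich P₀ (Q₁ x) (T x y')) ≤ K * L₁ := by
    intro x y
    -- Here the average goes over the test instead: `T ≤ K • ρ` turns it into the state averaged
    -- over `y'`, which `Q₁ x` flattens inside the sandwich.
    rw [expect_sum_smul, sandwich_smul_sum]
    have hF : ∑ y', r y' • T x y' ≤ K • ∑ y', r y' • ρ x y' := by
      rw [Finset.smul_sum]
      refine Finset.sum_le_sum fun y' _ => ?_
      rw [smul_comm]
      exact smul_le_smul_matrix (hr0 y') (hK x y')
    have hρ' : 0 ≤ Q₂ y * ρ x y * Q₂ y :=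
      IsSelfAdjoint.conjugate_nonneg (hρ0 x y) (h₂ y).isSelfAdjoint
    refine (expect_mono (sandwich_le h₀ (h₁ x) hK0 hL0 hF (hL x)) hρ').trans ?_
    rw [map_smul, smul_eq_mul, expect_one]
    refine mul_le_of_le_one_right (mul_nonneg hK0 hL0) ?_
    refine (trace_conj_le (h₂ y) (hρ0 x y)).trans_eq ?_
    rw [hρ1, Complex.one_re]
  calc _ = ∑ x, p x * ∑ y, r y * ∑ y', r y' *
        expect (Q₂ y * ρ x y * Q₂ y) (sandwich P₀ (Q₁ x) (T x y')) := by
        refine Finset.sum_congr rfl fun y _ => ?_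
        simp only [Finset.mul_sum]
        refine Finset.sum_congr rfl fun x' _ => Finset.sum_congr rfl fun x _ => by ring
    _ ≤ ∑ x, p x * ∑ y, r y * (K * L₁) := by
        gcongr with x _ y _
        · exact hp0 x
        · exact hr0 y
        · exact key x y
    _ = K * L₁ := by simp only [← Finset.sum_mul, hp1, hr1, one_mul]

/-- Both messages wrong. -/
theorem average_both_le (hr0 : ∀ y, 0 ≤ r y) (hr1 : ∑ y, r y = 1)
    (hp0 : ∀ x, 0 ≤ p x) (hp1 : ∑ x, p x = 1)
    (h₀ : IsStarProjection P₀) (h₁ : ∀ x, IsStarProjection (Q₁ x))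
    (hT0 : ∀ x y, 0 ≤ T x y) (hρ1 : ∀ x y, (ρ x y).trace = 1)
    (hK : ∀ x y, T x y ≤ K • ρ x y) (hL0 : 0 ≤ L₀)
    (h₂ρ : ∀ y, Q₂ y * (∑ x, p x • ρ x y) * Q₂ y ≤ ∑ x, p x • ρ x y)
    (hL : P₀ * (∑ x, ∑ y, (p x * r y) • ρ x y) * P₀ ≤ L₀ • 1) :
    ∑ x, ∑ x', p x * p x' * ∑ y, ∑ y', r y * r y' *
      expect (Q₂ y * ρ x y * Q₂ y) (sandwich P₀ (Q₁ x') (T x' y')) ≤ K * L₀ := by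
  have key : ∀ x' y', ∑ y, r y * ∑ x, p x *
      expect (Q₂ y * ρ x y * Q₂ y) (sandwich P₀ (Q₁ x') (T x' y')) ≤ K * L₀ := by
    intro x' y'
    simp only [fun y => expect_smul_sum p (fun x => Q₂ y * ρ x y * Q₂ y), conj_smul_sum]
    rw [expect_smul_sum]
    have hs := sandwich_nonneg h₀ (h₁ x') (hT0 x' y')
    -- The average over `x` comes first, because `Q₂ y` can be removed only from the state averaged
    -- over `x`.
    have hF : ∑ y, r y • (Q₂ y * (∑ x, p x • ρ x y) * Q₂ y) ≤
        ∑ x, ∑ y, (p x * r y) • ρ x y := by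
      rw [Finset.sum_comm]
      refine Finset.sum_le_sum fun y _ => (smul_le_smul_matrix (hr0 y) (h₂ρ y)).trans_eq ?_
      simp only [Finset.smul_sum, smul_smul, mul_comm]
    refine (expect_state_mono hs hF).trans ?_
    have hin : 0 ≤ Q₁ x' * T x' y' * Q₁ x' :=
      IsSelfAdjoint.conjugate_nonneg (hT0 x' y') (h₁ x').isSelfAdjoint
    -- The outer `P₀` moves from the test to the fully averaged state, which it flattens; the trace
    -- of what is left is bounded with a trivial outer projection.
    rw [sandwich, ← expect_conj, mul_comm K]
    refine (expect_le_of_le_smul_one hin hL).trans (mul_le_mul_of_nonneg_left ?_ hL0)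
    have := trace_sandwich_le (IsStarProjection.one _) (h₁ x') (hT0 x' y') (hρ1 x' y') (hK x' y')
    rwa [sandwich, one_mul, mul_one] at this
  calc _ = ∑ x', p x' * ∑ y', r y' * ∑ y, r y * ∑ x, p x *
        expect (Q₂ y * ρ x y * Q₂ y) (sandwich P₀ (Q₁ x') (T x' y')) := by
        rw [Finset.sum_comm]
        simp only [Finset.mul_sum]
        refine Finset.sum_congr rfl fun x' _ => ?_
        rw [Finset.sum_comm_cycle, Finset.sum_comm_cycle]
        rw [Finset.sum_comm]
        refine Finset.sum_congr rfl fun y' _ => ?_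
        refine Finset.sum_congr rfl fun x _ => Finset.sum_congr rfl fun y _ => by ring
    _ ≤ ∑ x', p x' * ∑ y', r y' * (K * L₀) := by
        gcongr with x _ y _
        · exact hp0 x
        · exact hr0 y
        · exact key x y
    _ = K * L₀ := by simp only [← Finset.sum_mul, hp1, hr1, one_mul]

end Averages

end OneShot

/-! ### Two independent codebooks: the mean error as a linear functional. -/

section RandomCoding

variable {X Y : Type*} [Fintype X] [Fintype Y] {M₁ M₂ : ℕ} {p : X → ℝ} {r : Y → ℝ}

/-- Expectation over two independent random codebooks. -/
def codebookMean (p : X → ℝ) (r : Y → ℝ) :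
    ((Fin M₁ → X) → (Fin M₂ → Y) → ℝ) →ₗ[ℝ] ℝ where
  toFun F := ∑ c₁, ∑ c₂, ((∏ m, p (c₁ m)) * ∏ m, r (c₂ m)) * F c₁ c₂
  map_add' F G := by simp [mul_add, Finset.sum_add_distrib]
  map_smul' a F := by
    simp only [Pi.smul_apply, smul_eq_mul, RingHom.id_apply, Finset.mul_sum]
    refine Finset.sum_congr rfl fun c₁ _ => Finset.sum_congr rfl fun c₂ _ => by ring

theorem codebookMean_apply (F : (Fin M₁ → X) → (Fin M₂ → Y) → ℝ) :
    codebookMean p r F = ∑ c₁, ∑ c₂, ((∏ m, p (c₁ m)) * ∏ m, r (c₂ m)) * F c₁ c₂ := rfl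

theorem codebookMean_apply' (F : (Fin M₁ → X) → (Fin M₂ → Y) → ℝ) :
    codebookMean p r F = ∑ c₁, (∏ m, p (c₁ m)) * ∑ c₂, (∏ m, r (c₂ m)) * F c₁ c₂ := by
  simp only [codebookMean_apply, Finset.mul_sum, mul_assoc]

theorem codebookMean_swap (F : (Fin M₁ → X) → (Fin M₂ → Y) → ℝ) :
    codebookMean p r F = ∑ c₂, (∏ m, r (c₂ m)) * ∑ c₁, (∏ m, p (c₁ m)) * F c₁ c₂ := by
  rw [codebookMean_apply, Finset.sum_comm]
  simp only [Finset.mul_sum]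
  refine Finset.sum_congr rfl fun c₁ _ => Finset.sum_congr rfl fun c₂ _ => by ring

theorem codebookMean_mono (hp0 : ∀ x, 0 ≤ p x) (hr0 : ∀ y, 0 ≤ r y)
    {F G : (Fin M₁ → X) → (Fin M₂ → Y) → ℝ} (h : ∀ c₁ c₂, F c₁ c₂ ≤ G c₁ c₂) :
    codebookMean p r F ≤ codebookMean p r G := by
  refine Finset.sum_le_sum fun c₁ _ => Finset.sum_le_sum fun c₂ _ =>
    mul_le_mul_of_nonneg_left (h c₁ c₂) ?_
  exact mul_nonneg (Finset.prod_nonneg fun m _ => hp0 _) (Finset.prod_nonneg fun m _ => hr0 _)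

variable (hp1 : ∑ x, p x = 1) (hr1 : ∑ y, r y = 1)
include hp1 hr1

theorem codebookMean_eval (a : Fin M₁) (b : Fin M₂) (g : X → Y → ℝ) :
    codebookMean p r (fun c₁ c₂ => g (c₁ a) (c₂ b)) = ∑ x, ∑ y, p x * r y * g x y := by
  simp only [codebookMean_apply', sum_codebook_eval hr1 b]
  rw [sum_codebook_eval hp1 a (fun x => ∑ y, r y * g x y)]
  simp only [Finset.mul_sum, mul_assoc]

theorem codebookMean_const [NeZero M₁] [NeZero M₂] (t : ℝ) :
    codebookMean p r (fun (_ : Fin M₁ → X) (_ : Fin M₂ → Y) => t) = t := by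
  rw [codebookMean_eval hp1 hr1 0 0 (fun _ _ => t)]
  simp [← Finset.mul_sum, ← Finset.sum_mul, hp1, hr1]

theorem codebookMean_eval_second (a : Fin M₁) {b b' : Fin M₂} (hb : b ≠ b')
    (g : X → Y → X → Y → ℝ) :
    codebookMean p r (fun c₁ c₂ => g (c₁ a) (c₂ b) (c₁ a) (c₂ b')) =
      ∑ x, p x * ∑ y, ∑ y', r y * r y' * g x y x y' := by
  simp only [codebookMean_apply']
  rw [← sum_codebook_eval hp1 a]
  refine Finset.sum_congr rfl fun c₁ _ => ?_
  rw [sum_codebook_eval₂ hr1 hb (fun y y' => g (c₁ a) y (c₁ a) y')]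

theorem codebookMean_eval_first {a a' : Fin M₁} (ha : a ≠ a') (b : Fin M₂)
    (g : X → Y → X → Y → ℝ) :
    codebookMean p r (fun c₁ c₂ => g (c₁ a) (c₂ b) (c₁ a') (c₂ b)) =
      ∑ y, r y * ∑ x, ∑ x', p x * p x' * g x y x' y := by
  simp only [codebookMean_swap]
  rw [← sum_codebook_eval hr1 b]
  refine Finset.sum_congr rfl fun c₂ _ => ?_
  rw [sum_codebook_eval₂ hp1 ha (fun x x' => g x (c₂ b) x' (c₂ b))]

theorem codebookMean_eval_both {a a' : Fin M₁} (ha : a ≠ a') {b b' : Fin M₂} (hb : b ≠ b')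
    (g : X → Y → X → Y → ℝ) :
    codebookMean p r (fun c₁ c₂ => g (c₁ a) (c₂ b) (c₁ a') (c₂ b')) =
      ∑ x, ∑ x', p x * p x' * ∑ y, ∑ y', r y * r y' * g x y x' y' := by
  simp only [codebookMean_apply']
  rw [← sum_codebook_eval₂ hp1 ha]
  refine Finset.sum_congr rfl fun c₁ _ => ?_
  rw [sum_codebook_eval₂ hr1 hb (fun y y' => g (c₁ a) y (c₁ a') y')]

end RandomCoding

theorem Fin.sum_ite_eq_add {M : ℕ} (m : Fin M) (u v : ℝ) :
    ∑ b, (if b = m then u else v) = u + ((M : ℝ) - 1) * v := by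
  have : ∀ b, (if b = m then u else v) = (if b = m then u - v else 0) + v := by
    intro b
    split_ifs <;> ring
  simp only [this, Finset.sum_add_distrib, Finset.sum_ite_eq', Finset.mem_univ, if_true,
    Finset.sum_const, Finset.card_univ, Fintype.card_fin, nsmul_eq_mul]
  ring

/-- Counts the competitors of each kind. The erased pair would fall in the first branch, hence `M₂ -
1` copies of `u`. -/
theorem Fin.sum_erase_prod {M₁ M₂ : ℕ} (m : Fin M₁ × Fin M₂) (u v w : ℝ) :
    ∑ o ∈ Finset.univ.erase m, (if o.1 = m.1 then u else if o.2 = m.2 then v else w) =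
      ((M₁ : ℝ) - 1) * v + ((M₂ : ℝ) - 1) * u + ((M₁ : ℝ) - 1) * ((M₂ : ℝ) - 1) * w := by
  have h := Finset.add_sum_erase Finset.univ
    (fun o : Fin M₁ × Fin M₂ => if o.1 = m.1 then u else if o.2 = m.2 then v else w)
    (Finset.mem_univ m)
  simp only [if_true] at h
  have h2 : ∑ o : Fin M₁ × Fin M₂, (if o.1 = m.1 then u else if o.2 = m.2 then v else w) =
      M₂ * u + ((M₁ : ℝ) - 1) * (v + ((M₂ : ℝ) - 1) * w) := by
    rw [Fintype.sum_prod_type, ← Fin.sum_ite_eq_add m.1]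
    refine Finset.sum_congr rfl fun a _ => ?_
    dsimp only
    split_ifs
    · simp
    · exact Fin.sum_ite_eq_add m.2 v w
  rw [h2] at h
  linear_combination h

/-! ### The one-shot simultaneous decoder. -/

section OneShot

open scoped MatrixOrder Matrix.Norms.L2Operator

variable {ι : Type*} [Fintype ι] [DecidableEq ι]
variable {X Y : Type*} [Fintype X] [Fintype Y]

/-- A one-shot simultaneous decoder for two senders: four families of tests bound the random
coding error. -/
theorem exists_simultaneous_decoder {p : X → ℝ} {r : Y → ℝ} {ρ : X → Y → Matrix ι ι ℂ}
    {P₀ : Matrix ι ι ℂ} {Q₁ : X → Matrix ι ι ℂ} {Q₂ : Y → Matrix ι ι ℂ}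
    {T : X → Y → Matrix ι ι ℂ} {K L₀ L₁ L₂ η : ℝ} {M₁ M₂ : ℕ} [NeZero M₁] [NeZero M₂]
    (hp0 : ∀ x, 0 ≤ p x) (hp1 : ∑ x, p x = 1) (hr0 : ∀ y, 0 ≤ r y) (hr1 : ∑ y, r y = 1)
    (h₀ : IsStarProjection P₀) (h₁ : ∀ x, IsStarProjection (Q₁ x))
    (h₂ : ∀ y, IsStarProjection (Q₂ y))
    (hT0 : ∀ x y, 0 ≤ T x y) (hT1 : ∀ x y, T x y ≤ 1)
    (hρ0 : ∀ x y, 0 ≤ ρ x y) (hρ1 : ∀ x y, (ρ x y).trace = 1)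
    (hK0 : 0 ≤ K) (hK : ∀ x y, T x y ≤ K • ρ x y)
    (hL₀0 : 0 ≤ L₀) (hL₁0 : 0 ≤ L₁) (hL₂0 : 0 ≤ L₂)
    (hL₀ : P₀ * (∑ x, ∑ y, (p x * r y) • ρ x y) * P₀ ≤ L₀ • 1)
    (hL₁ : ∀ x, Q₁ x * (∑ y, r y • ρ x y) * Q₁ x ≤ L₁ • 1)
    (hL₂ : ∀ y, Q₂ y * (∑ x, p x • ρ x y) * Q₂ y ≤ L₂ • 1)
    (h₂ρ : ∀ y, Q₂ y * (∑ x, p x • ρ x y) * Q₂ y ≤ ∑ x, p x • ρ x y)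
    (hη : 0 < η) :
    ∃ Λ : (Fin M₁ → X) → (Fin M₂ → Y) → QMAC.POVM ι (Fin M₁ × Fin M₂),
      codebookMean p r (fun c₁ c₂ => (1 / ((M₁ : ℝ) * (M₂ : ℝ))) *
        ∑ m₁, ∑ m₂, expect (ρ (c₁ m₁) (c₂ m₂)) (1 - (Λ c₁ c₂).op (m₁, m₂))) ≤
      48 * (∑ x, ∑ y, p x * r y * (expect (ρ x y) (1 - P₀) + expect (ρ x y) (1 - Q₁ x) +
        expect (ρ x y) (1 - Q₂ y) + expect (ρ x y) (1 - T x y))) +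
      8 * (((M₁ : ℝ) - 1) * (K * L₂) + ((M₂ : ℝ) - 1) * (K * L₁) +
        ((M₁ : ℝ) - 1) * ((M₂ : ℝ) - 1) * (K * L₀)) + 8 * η := by
  choose Λ hΛ using fun (c₁ : Fin M₁ → X) (c₂ : Fin M₂ → Y) =>
    exists_povm_expect_error_le ((0, 0) : Fin M₁ × Fin M₂) P₀ (fun o => Q₁ (c₁ o.1))
      (fun o => T (c₁ o.1) (c₂ o.2)) h₀ (fun o => h₁ _) (fun o => hT0 _ _) (fun o => hT1 _ _) hη
  refine ⟨Λ, ?_⟩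
  set e : X → Y → ℝ := fun x y => expect (ρ x y) (1 - P₀) + expect (ρ x y) (1 - Q₁ x) +
        expect (ρ x y) (1 - Q₂ y) + expect (ρ x y) (1 - T x y) with he
  set f : X → Y → X → Y → ℝ := fun x y x' y' =>
    expect (Q₂ y * ρ x y * Q₂ y) (sandwich P₀ (Q₁ x') (T x' y')) with hf
  set R : ℝ := 48 * (∑ x, ∑ y, p x * r y * e x y) +
      8 * (((M₁ : ℝ) - 1) * (K * L₂) + ((M₂ : ℝ) - 1) * (K * L₁) +
        ((M₁ : ℝ) - 1) * ((M₂ : ℝ) - 1) * (K * L₀)) + 8 * η with hR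
  have key : ∀ m₁ m₂, codebookMean p r
      (fun c₁ c₂ => expect (ρ (c₁ m₁) (c₂ m₂)) (1 - (Λ c₁ c₂).op (m₁, m₂))) ≤ R := by
    intro m₁ m₂
    have step : ∀ c₁ c₂, expect (ρ (c₁ m₁) (c₂ m₂)) (1 - (Λ c₁ c₂).op (m₁, m₂)) ≤
        48 * e (c₁ m₁) (c₂ m₂) +
        8 * (∑ o ∈ Finset.univ.erase (m₁, m₂), f (c₁ m₁) (c₂ m₂) (c₁ o.1) (c₂ o.2)) + 8 * η :=
      fun c₁ c₂ => hΛ c₁ c₂ (m₁, m₂) _ _ (h₂ (c₂ m₂)) (hρ0 _ _) (hρ1 _ _)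
    refine (codebookMean_mono hp0 hr0 step).trans ?_
    have lin : codebookMean p r (fun (c₁ : Fin M₁ → X) (c₂ : Fin M₂ → Y) =>
        48 * e (c₁ m₁) (c₂ m₂) +
        8 * (∑ o ∈ Finset.univ.erase (m₁, m₂), f (c₁ m₁) (c₂ m₂) (c₁ o.1) (c₂ o.2)) + 8 * η) =
        48 * codebookMean p r (fun (c₁ : Fin M₁ → X) (c₂ : Fin M₂ → Y) => e (c₁ m₁) (c₂ m₂)) +
        8 * (∑ o ∈ Finset.univ.erase (m₁, m₂), codebookMean p r
          (fun (c₁ : Fin M₁ → X) (c₂ : Fin M₂ → Y) => f (c₁ m₁) (c₂ m₂) (c₁ o.1) (c₂ o.2))) +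
        codebookMean p r (fun (_ : Fin M₁ → X) (_ : Fin M₂ → Y) => 8 * η) := by
      simp only [← smul_eq_mul, ← map_smul, ← map_sum, ← map_add]
      congr 1
      funext c₁ c₂
      simp
    rw [lin, codebookMean_const hp1 hr1, codebookMean_eval hp1 hr1]
    -- A competitor sharing one message shares that codeword with the transmitted pair, so each of
    -- the three cases has its own joint law.
    have bound : ∀ o ∈ Finset.univ.erase (m₁, m₂), codebookMean p r
          (fun (c₁ : Fin M₁ → X) (c₂ : Fin M₂ → Y) => f (c₁ m₁) (c₂ m₂) (c₁ o.1) (c₂ o.2)) ≤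
        if o.1 = (m₁, m₂).1 then K * L₁ else if o.2 = (m₁, m₂).2 then K * L₂ else K * L₀ := by
      rintro ⟨a, b⟩ ho
      dsimp only
      split_ifs with ha hb
      · subst ha
        have hb : m₂ ≠ b := by
          rintro rfl
          simp at ho
        rw [codebookMean_eval_second hp1 hr1 a hb f]
        exact average_second_le hr0 hr1 hp0 hp1 h₀ h₁ h₂ hρ0 hρ1 hK0 hK hL₁0 hL₁
      · subst hb
        rw [codebookMean_eval_first hp1 hr1 (Ne.symm ha) b f]
        exact average_first_le hr0 hr1 hp0 hp1 h₀ h₁ hT0 hρ1 hK hL₂0 hL₂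
      · rw [codebookMean_eval_both hp1 hr1 (Ne.symm ha) (Ne.symm hb) f]
        exact average_both_le hr0 hr1 hp0 hp1 h₀ h₁ hT0 hρ1 hK hL₀0 h₂ρ hL₀
    have := Finset.sum_le_sum bound
    rw [Fin.sum_erase_prod] at this
    rw [hR]
    linarith
  have hM : (0 : ℝ) < (M₁ : ℝ) * M₂ := by
    have h1 := NeZero.pos M₁
    have h2 := NeZero.pos M₂
    positivity
  have lin : codebookMean p r (fun (c₁ : Fin M₁ → X) (c₂ : Fin M₂ → Y) =>
      (1 / ((M₁ : ℝ) * (M₂ : ℝ))) *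
        ∑ m₁, ∑ m₂, expect (ρ (c₁ m₁) (c₂ m₂)) (1 - (Λ c₁ c₂).op (m₁, m₂))) =
      (1 / ((M₁ : ℝ) * (M₂ : ℝ))) * ∑ m₁, ∑ m₂, codebookMean p r
        (fun c₁ c₂ => expect (ρ (c₁ m₁) (c₂ m₂)) (1 - (Λ c₁ c₂).op (m₁, m₂))) := by
    simp only [← smul_eq_mul, ← map_smul, ← map_sum]
    congr 1
    funext c₁ c₂
    simp
  rw [lin]
  calc _ ≤ (1 / ((M₁ : ℝ) * (M₂ : ℝ))) * ∑ _m₁ : Fin M₁, ∑ _m₂ : Fin M₂, R := by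
        gcongr with m₁ _ m₂ _
        exact key m₁ m₂
    _ = R := by
        simp only [Finset.sum_const, Finset.card_univ, Fintype.card_fin, nsmul_eq_mul]
        field_simp
        rw [mul_div_cancel_left₀ _ hM.ne']

end OneShot

/-! ### Tensor powers of matrices. -/

section Tensor

open scoped MatrixOrder Matrix.Norms.L2Operator

variable {B : Type*} [Fintype B] [DecidableEq B] {n : ℕ}

/-- The tensor product `A₁ ⊗ ⋯ ⊗ Aₙ` of square matrices. -/
def tensor (A : Fin n → Matrix B B ℂ) : Matrix (Fin n → B) (Fin n → B) ℂ :=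
  fun b b' => ∏ k, A k (b k) (b' k)

theorem tensor_apply (A : Fin n → Matrix B B ℂ) (b b' : Fin n → B) :
    tensor A b b' = ∏ k, A k (b k) (b' k) := rfl

theorem tensor_mul (A C : Fin n → Matrix B B ℂ) :
    tensor A * tensor C = tensor fun k => A k * C k := by
  ext b b'
  simp only [Matrix.mul_apply, tensor_apply, ← Finset.prod_mul_distrib]
  rw [Finset.prod_univ_sum, Fintype.piFinset_univ]

theorem tensor_conjTranspose (A : Fin n → Matrix B B ℂ) :
    (tensor A)ᴴ = tensor fun k => (A k)ᴴ := by
  ext b b'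
  simp [Matrix.conjTranspose_apply, tensor_apply]

theorem tensor_diagonal (d : Fin n → B → ℂ) :
    tensor (fun k => Matrix.diagonal (d k)) = Matrix.diagonal fun b => ∏ k, d k (b k) := by
  ext b b'
  simp only [tensor_apply, Matrix.diagonal_apply]
  split_ifs with h
  · subst h
    simp
  · obtain ⟨k, hk⟩ := Function.ne_iff.1 h
    exact Finset.prod_eq_zero (Finset.mem_univ k) (if_neg hk)

theorem tensor_one : tensor (fun _ : Fin n => (1 : Matrix B B ℂ)) = 1 := by
  simp only [← Matrix.diagonal_one]
  rw [tensor_diagonal]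
  simp

/-- Multilinearity: averaging over product inputs keeps the output a product state, so its spectrum
stays explicit. -/
theorem sum_smul_tensor {α : Type*} [Fintype α] (w : Fin n → α → ℝ)
    (A : Fin n → α → Matrix B B ℂ) :
    ∑ x : Fin n → α, (∏ k, w k (x k)) • tensor (fun k => A k (x k)) =
      tensor fun k => ∑ a, w k a • A k a := by
  classical
  ext b b'
  simp only [Matrix.sum_apply, Matrix.smul_apply, tensor_apply]
  rw [Finset.prod_univ_sum, Fintype.piFinset_univ]
  refine Finset.sum_congr rfl fun x _ => ?_
  simp [Finset.prod_mul_distrib]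

end Tensor

/-! ### Functional calculus in a fixed orthonormal basis. -/

section Spectral

open scoped MatrixOrder Matrix.Norms.L2Operator

variable {ι : Type*} [Fintype ι] [DecidableEq ι]

/-- The operator with real spectrum `f` in the orthonormal basis given by the columns of `V`. -/
def spectralOp (V : Matrix ι ι ℂ) (f : ι → ℝ) : Matrix ι ι ℂ :=
  V * Matrix.diagonal (fun i => (f i : ℂ)) * Vᴴ

variable {V : Matrix ι ι ℂ}

theorem spectralOp_nonneg {f : ι → ℝ} (hf : ∀ i, 0 ≤ f i) : 0 ≤ spectralOp V f := by
  refine Matrix.nonneg_iff_posSemidef.2 (Matrix.PosSemidef.mul_mul_conjTranspose_same ?_ V)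
  refine Matrix.PosSemidef.diagonal fun i => ?_
  exact Complex.zero_le_real.2 (hf i)

theorem spectralOp_sub (f g : ι → ℝ) :
    spectralOp V f - spectralOp V g = spectralOp V (fun i => f i - g i) := by
  rw [spectralOp, spectralOp, spectralOp, ← sub_mul, ← mul_sub, Matrix.diagonal_sub]
  simp

theorem spectralOp_smul (c : ℝ) (f : ι → ℝ) :
    c • spectralOp V f = spectralOp V (fun i => c * f i) := by
  rw [spectralOp, spectralOp, ← smul_mul_assoc, ← mul_smul_comm, ← Matrix.diagonal_smul]
  congr 3
  funext i
  simp

theorem spectralOp_mono {f g : ι → ℝ} (h : ∀ i, f i ≤ g i) :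
    spectralOp V f ≤ spectralOp V g := by
  rw [← sub_nonneg, spectralOp_sub]
  exact spectralOp_nonneg fun i => sub_nonneg.2 (h i)

theorem spectralOp_isSelfAdjoint (f : ι → ℝ) : IsSelfAdjoint (spectralOp V f) := by
  change (spectralOp V f)ᴴ = _
  rw [spectralOp, Matrix.conjTranspose_mul, Matrix.conjTranspose_mul,
    Matrix.conjTranspose_conjTranspose, Matrix.diagonal_conjTranspose, mul_assoc]
  congr 3
  funext i
  simp

variable (hV : Vᴴ * V = 1)
include hV

theorem spectralOp_one : spectralOp V (fun _ => 1) = 1 := by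
  simp [spectralOp, mul_eq_one_comm.1 hV]

theorem spectralOp_mul (f g : ι → ℝ) :
    spectralOp V f * spectralOp V g = spectralOp V (fun i => f i * g i) := by
  calc _ = V * Matrix.diagonal (fun i => (f i : ℂ)) * (Vᴴ * V) *
        Matrix.diagonal (fun i => (g i : ℂ)) * Vᴴ := by simp only [spectralOp, mul_assoc]
    _ = _ := by
        rw [hV, mul_one, mul_assoc V, Matrix.diagonal_mul_diagonal, spectralOp]
        simp

theorem spectralOp_trace (f : ι → ℝ) : (spectralOp V f).trace.re = ∑ i, f i := by
  rw [spectralOp, Matrix.trace_mul_comm, ← mul_assoc, hV, one_mul, Matrix.trace_diagonal]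
  simp

theorem spectralOp_isStarProjection {s : ι → Prop} [DecidablePred s] :
    IsStarProjection (spectralOp V fun i => if s i then 1 else 0) :=
  ⟨by
    rw [IsIdempotentElem, spectralOp_mul hV]
    congr 1
    funext i
    split_ifs <;> simp, spectralOp_isSelfAdjoint _⟩

theorem expect_spectralOp_one_sub (f : ι → ℝ) (s : ι → Prop) [DecidablePred s] :
    expect (spectralOp V f) (1 - spectralOp V fun i => if s i then 1 else 0) =
      ∑ i, if s i then 0 else f i := by
  rw [expect_apply, ← spectralOp_one hV, spectralOp_sub, spectralOp_mul hV, spectralOp_trace hV]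
  refine Finset.sum_congr rfl fun i _ => ?_
  split_ifs <;> simp

theorem spectralOp_conj (f : ι → ℝ) (s : ι → Prop) [DecidablePred s] :
    (spectralOp V fun i => if s i then 1 else 0) * spectralOp V f *
      (spectralOp V fun i => if s i then 1 else 0) =
      spectralOp V fun i => if s i then f i else 0 := by
  rw [spectralOp_mul hV, spectralOp_mul hV]
  congr 1
  funext i
  split_ifs <;> simp

end Spectral

/-! ### Spectra and spectral tests of product states. -/

section ProductStates

open scoped MatrixOrder Matrix.Norms.L2Operator
open QMAC

variable {B : Type*} [Fintype B] [DecidableEq B] {n : ℕ}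

/-- The eigenvalues of a density matrix. -/
def QMAC.DensityMatrix.spec (σ : DensityMatrix B) : B → ℝ := σ.posSemidef.isHermitian.eigenvalues

/-- A unitary matrix that diagonalizes a density matrix. -/
def QMAC.DensityMatrix.basis (σ : DensityMatrix B) : Matrix B B ℂ :=
  σ.posSemidef.isHermitian.eigenvectorUnitary

namespace QMAC.DensityMatrix

theorem basis_unitary (σ : DensityMatrix B) : σ.basisᴴ * σ.basis = 1 :=
  (Matrix.mem_unitaryGroup_iff').1 σ.posSemidef.isHermitian.eigenvectorUnitary.2

theorem mat_eq (σ : DensityMatrix B) : σ.mat = spectralOp σ.basis σ.spec := by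
  have := σ.posSemidef.isHermitian.spectral_theorem
  rw [Unitary.conjStarAlgAut_apply] at this
  exact this

theorem spec_nonneg (σ : DensityMatrix B) (b : B) : 0 ≤ σ.spec b :=
  σ.posSemidef.eigenvalues_nonneg b

theorem spec_sum (σ : DensityMatrix B) : ∑ b, σ.spec b = 1 := by
  rw [← spectralOp_trace σ.basis_unitary, ← mat_eq, σ.trace_eq_one, Complex.one_re]

theorem entropy_eq (σ : DensityMatrix B) :
    σ.entropy = -∑ b, σ.spec b * Real.logb 2 (σ.spec b) := rfl

end QMAC.DensityMatrix

/-- The product basis that diagonalizes a product state. -/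
def prodBasis (σ : Fin n → DensityMatrix B) : Matrix (Fin n → B) (Fin n → B) ℂ :=
  tensor fun k => (σ k).basis

/-- The eigenvalues of a product state. -/
def prodSpec (σ : Fin n → DensityMatrix B) (b : Fin n → B) : ℝ := ∏ k, (σ k).spec (b k)

/-- The product state `σ₁ ⊗ ⋯ ⊗ σₙ`. -/
def prodState (σ : Fin n → DensityMatrix B) : Matrix (Fin n → B) (Fin n → B) ℂ :=
  tensor fun k => (σ k).mat

variable (σ : Fin n → DensityMatrix B)

theorem prodBasis_unitary : (prodBasis σ)ᴴ * prodBasis σ = 1 := by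
  rw [prodBasis, tensor_conjTranspose, tensor_mul]
  simp only [DensityMatrix.basis_unitary, tensor_one]

theorem prodState_eq : prodState σ = spectralOp (prodBasis σ) (prodSpec σ) := by
  rw [prodState, spectralOp, prodBasis, tensor_conjTranspose]
  have : Matrix.diagonal (fun b => ((prodSpec σ b : ℝ) : ℂ)) =
      tensor (fun k => Matrix.diagonal fun b => (((σ k).spec b : ℝ) : ℂ)) := by
    rw [tensor_diagonal]
    simp [prodSpec]
  rw [this, tensor_mul, tensor_mul]
  congr 1
  funext k
  exact (σ k).mat_eq

theorem prodSpec_nonneg (b : Fin n → B) : 0 ≤ prodSpec σ b :=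
  Finset.prod_nonneg fun k _ => (σ k).spec_nonneg _

theorem prodState_nonneg : 0 ≤ prodState σ := by
  rw [prodState_eq]
  exact spectralOp_nonneg (prodSpec_nonneg σ)

theorem prodState_trace : (prodState σ).trace = 1 := by
  simp only [Matrix.trace, Matrix.diag, prodState, tensor_apply]
  have := (Finset.prod_univ_sum (fun _ : Fin n => Finset.univ) fun k b => (σ k).mat b b).symm
  rw [Fintype.piFinset_univ] at this
  rw [this]
  exact Finset.prod_eq_one fun k _ => (σ k).trace_eq_one

/-- The projection onto the eigenvalues of a product state that are at most `L`. -/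
def lowTest (L : ℝ) : Matrix (Fin n → B) (Fin n → B) ℂ := by
  classical
  exact spectralOp (prodBasis σ) fun b => if prodSpec σ b ≤ L then 1 else 0

/-- The projection onto the eigenvalues of a product state that are at least `L`. -/
def highTest (L : ℝ) : Matrix (Fin n → B) (Fin n → B) ℂ := by
  classical
  exact spectralOp (prodBasis σ) fun b => if L ≤ prodSpec σ b then 1 else 0

theorem lowTest_isStarProjection (L : ℝ) : IsStarProjection (lowTest σ L) :=
  spectralOp_isStarProjection (prodBasis_unitary σ)

theorem highTest_isStarProjection (L : ℝ) : IsStarProjection (highTest σ L) :=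
  spectralOp_isStarProjection (prodBasis_unitary σ)

theorem lowTest_conj_le {L : ℝ} (hL : 0 ≤ L) :
    lowTest σ L * prodState σ * lowTest σ L ≤ L • 1 := by
  classical
  rw [lowTest, prodState_eq, spectralOp_conj (prodBasis_unitary σ),
    ← spectralOp_one (prodBasis_unitary σ), spectralOp_smul]
  refine spectralOp_mono fun b => ?_
  split_ifs with h
  · simpa using h
  · simpa using hL

/-- The test commutes with its own state, so compression only deletes eigenvalues. This lets the
smoothing be dropped when both messages are wrong. -/
theorem lowTest_conj_le_self (L : ℝ) :
    lowTest σ L * prodState σ * lowTest σ L ≤ prodState σ := by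
  classical
  rw [lowTest, prodState_eq, spectralOp_conj (prodBasis_unitary σ)]
  refine spectralOp_mono fun b => ?_
  split_ifs
  exacts [le_rfl, prodSpec_nonneg σ b]

theorem highTest_le {L : ℝ} (hL : 0 < L) : highTest σ L ≤ L⁻¹ • prodState σ := by
  classical
  rw [highTest, prodState_eq, spectralOp_smul]
  refine spectralOp_mono fun b => ?_
  split_ifs with h
  · rwa [← div_eq_inv_mul, one_le_div hL]
  · exact mul_nonneg (inv_nonneg.2 hL.le) (prodSpec_nonneg σ b)

open Classical in
theorem expect_one_sub_lowTest (L : ℝ) : expect (prodState σ) (1 - lowTest σ L) =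
    ∑ b, if prodSpec σ b ≤ L then 0 else prodSpec σ b := by
  rw [lowTest, prodState_eq, expect_spectralOp_one_sub (prodBasis_unitary σ)]

open Classical in
theorem expect_one_sub_highTest (L : ℝ) : expect (prodState σ) (1 - highTest σ L) =
    ∑ b, if L ≤ prodSpec σ b then 0 else prodSpec σ b := by
  rw [highTest, prodState_eq, expect_spectralOp_one_sub (prodBasis_unitary σ)]

/-- The mixture of a finite ensemble of density matrices. -/
def QMAC.DensityMatrix.mix {α : Type*} [Fintype α] (w : stdSimplex ℝ α)
    (τ : α → DensityMatrix B) : DensityMatrix B where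
  mat := ∑ a, w a • (τ a).mat
  posSemidef := Matrix.posSemidef_sum _ fun a _ => (τ a).posSemidef.smul (w.2.1 a)
  trace_eq_one := by
    have h : ∑ a, w a = (1 : ℝ) := w.2.2
    simp only [Matrix.trace_sum, Matrix.trace_smul, (τ _).trace_eq_one]
    rw [← Finset.sum_smul, h, one_smul]

theorem sum_smul_prodState {α : Type*} [Fintype α] (w : Fin n → stdSimplex ℝ α)
    (τ : Fin n → α → DensityMatrix B) :
    ∑ x : Fin n → α, (∏ k, w k (x k)) • prodState (fun k => τ k (x k)) =
      prodState fun k => DensityMatrix.mix (w k) (τ k) :=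
  sum_smul_tensor (fun k a => w k a) (fun k a => (τ k a).mat)

end ProductStates

/-! ### A weak law on finite alphabets. -/

section LawOfLargeNumbers

variable {A : Type*} [Fintype A] {μ : A → ℝ}

/-- Variance of an i.i.d. sum: independence and mean zero kill the cross terms. -/
theorem sum_iid_sq (h1 : ∑ a, μ a = 1) {g : A → ℝ} (hg : ∑ a, μ a * g a = 0) (n : ℕ) :
    ∑ a : Fin n → A, (∏ i, μ (a i)) * (∑ i, g (a i)) ^ 2 = n * ∑ a, μ a * g a ^ 2 := by
  have e : ∀ a : Fin n → A, (∏ i, μ (a i)) * (∑ i, g (a i)) ^ 2 =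
      ∑ i, ∑ j, (∏ i, μ (a i)) * (g (a i) * g (a j)) := by
    intro a
    rw [sq, Finset.sum_mul_sum, Finset.mul_sum]
    simp only [Finset.mul_sum]
  simp only [e]
  rw [Finset.sum_comm]
  have : ∀ i : Fin n, ∑ a : Fin n → A, ∑ j, (∏ i, μ (a i)) * (g (a i) * g (a j)) =
      ∑ a, μ a * g a ^ 2 := by
    intro i
    rw [Finset.sum_comm, Finset.sum_eq_single i]
    · simp only [← sq]
      exact sum_codebook_eval h1 i fun a => g a ^ 2
    · intro j _ hj
      rw [sum_codebook_eval_mul_eval h1 hj.symm g g, hg, zero_mul]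
    · simp
  simp [this]

open Classical in
/-- Chebyshev's inequality for the empirical mean of a function on a finite alphabet. -/
theorem sum_iid_deviation_le (h0 : ∀ a, 0 ≤ μ a) (h1 : ∑ a, μ a = 1) (f : A → ℝ) {n : ℕ}
    (hn : 0 < n) {δ : ℝ} (hδ : 0 < δ) :
    ∑ a : Fin n → A, (if n * δ ≤ |∑ i, f (a i) - n * ∑ a, μ a * f a| then ∏ i, μ (a i) else 0) ≤
      (∑ a, μ a * (f a - ∑ a, μ a * f a) ^ 2) / (n * δ ^ 2) := by
  set m := ∑ a, μ a * f a with hm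
  have hn' : (0 : ℝ) < n := by exact_mod_cast hn
  have hg : ∑ a, μ a * (f a - m) = 0 := by
    simp only [mul_sub, Finset.sum_sub_distrib, ← Finset.sum_mul, h1, one_mul, ← hm, sub_self]
  have key := sum_iid_sq h1 hg n
  rw [le_div_iff₀ (by positivity)]
  have : (∑ a : Fin n → A, (if n * δ ≤ |∑ i, f (a i) - n * m| then ∏ i, μ (a i) else 0)) *
      (n * δ) ^ 2 ≤ n * ∑ a, μ a * (f a - m) ^ 2 := by
    rw [← key, Finset.sum_mul]
    refine Finset.sum_le_sum fun a _ => ?_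
    have hp : 0 ≤ ∏ i, μ (a i) := Finset.prod_nonneg fun i _ => h0 _
    have hs : ∑ i, (f (a i) - m) = ∑ i, f (a i) - n * m := by
      simp [Finset.sum_sub_distrib]
    rw [hs]
    split_ifs with h
    · refine mul_le_mul_of_nonneg_left ?_ hp
      rw [← sq_abs (∑ i, f (a i) - n * m)]
      exact pow_le_pow_left₀ (by positivity) h 2
    · rw [zero_mul]
      positivity
  have h2 : n * ((∑ a : Fin n → A, (if n * δ ≤ |∑ i, f (a i) - n * m| then ∏ i, μ (a i) else 0)) *
      (n * δ ^ 2)) ≤ n * ∑ a, μ a * (f a - m) ^ 2 := by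
    refine le_trans (le_of_eq ?_) this
    ring
  exact le_of_mul_le_mul_left h2 hn'

open Classical in
theorem exists_sum_iid_deviation_le (h0 : ∀ a, 0 ≤ μ a) (h1 : ∑ a, μ a = 1) (f : A → ℝ)
    {ε δ : ℝ} (hε : 0 < ε) (hδ : 0 < δ) :
    ∃ N : ℕ, ∀ n ≥ N, ∑ a : Fin n → A,
      (if n * δ ≤ |∑ i, f (a i) - n * ∑ a, μ a * f a| then ∏ i, μ (a i) else 0) ≤ ε := by
  set V := ∑ a, μ a * (f a - ∑ a, μ a * f a) ^ 2
  obtain ⟨N, hN⟩ := exists_nat_gt (V / (ε * δ ^ 2))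
  -- The extra one excludes `n = 0`, where the bound divides by zero.
  refine ⟨N + 1, fun n hn => (sum_iid_deviation_le h0 h1 f (by omega) hδ).trans ?_⟩
  have hn0 : (0 : ℝ) < n := by exact_mod_cast (show 0 < n by omega)
  have hNn : (N : ℝ) ≤ n := by exact_mod_cast (show N ≤ n by omega)
  rw [div_le_iff₀ (by positivity)]
  rw [div_lt_iff₀ (by positivity)] at hN
  have : (N : ℝ) * (ε * δ ^ 2) ≤ n * (ε * δ ^ 2) :=
    mul_le_mul_of_nonneg_right hNn (by positivity)
  linarith

end LawOfLargeNumbers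

/-! ### Concentration of log-eigenvalues. -/

section Typicality

open QMAC

variable {Ω B : Type*} [Fintype Ω] [Fintype B] [DecidableEq B]

theorem logb_prodSpec {n : ℕ} {σ : Fin n → DensityMatrix B} {b : Fin n → B}
    (h : prodSpec σ b ≠ 0) : Real.logb 2 (prodSpec σ b) = ∑ i, Real.logb 2 ((σ i).spec (b i)) :=
  Real.logb_prod _ _ fun i _ => Finset.prod_ne_zero_iff.1 h i (Finset.mem_univ i)

open Classical in
/-- Eigenvalues of random product states concentrate: a condition on the eigenvalues that can fail
only if the normalized log-eigenvalue deviates from minus the average entropy has probability close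
to one. -/
theorem exists_sum_atypical_le {w : Ω → ℝ} (hw0 : ∀ a, 0 ≤ w a) (hw1 : ∑ a, w a = 1)
    (σ : Ω → DensityMatrix B) {ε δ : ℝ} (hε : 0 < ε) (hδ : 0 < δ) :
    ∃ N : ℕ, ∀ n ≥ N, ∀ s : ℝ → Prop,
      (∀ t, 0 < t → |-Real.logb 2 t - n * ∑ a, w a * (σ a).entropy| < n * δ → s t) →
      ∑ x : Fin n → Ω, (∏ i, w (x i)) * (∑ b, if s (prodSpec (fun i => σ (x i)) b) then 0
        else prodSpec (fun i => σ (x i)) b) ≤ ε := by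
  -- The joint law of an input letter and an eigenvalue label of its state. Under `n` independent
  -- copies, `-log₂` of the product eigenvalue is an i.i.d. sum whose mean per letter is the average
  -- entropy.
  let μ : Ω × B → ℝ := fun a => w a.1 * (σ a.1).spec a.2
  have hμ0 : ∀ a, 0 ≤ μ a := fun a => mul_nonneg (hw0 _) ((σ _).spec_nonneg _)
  have hμ1 : ∑ a, μ a = 1 := by
    simp only [μ, Fintype.sum_prod_type, ← Finset.mul_sum, DensityMatrix.spec_sum, mul_one, hw1]
  let f : Ω × B → ℝ := fun a => -Real.logb 2 ((σ a.1).spec a.2)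
  have hmean : ∑ a, μ a * f a = ∑ a, w a * (σ a).entropy := by
    simp only [μ, f, Fintype.sum_prod_type, DensityMatrix.entropy_eq]
    refine Finset.sum_congr rfl fun a _ => ?_
    rw [← Finset.sum_neg_distrib, Finset.mul_sum]
    refine Finset.sum_congr rfl fun b _ => by ring
  obtain ⟨N, hN⟩ := exists_sum_iid_deviation_le hμ0 hμ1 f hε hδ
  refine ⟨N, fun n hn s hs => le_trans ?_ (hN n hn)⟩
  rw [hmean]
  rw [← (Equiv.arrowProdEquivProdArrow (Fin n) (fun _ => Ω) (fun _ => B)).symm.sum_comp,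
    Fintype.sum_prod_type]
  refine Finset.sum_le_sum fun x _ => ?_
  rw [Finset.mul_sum]
  refine Finset.sum_le_sum fun b _ => ?_
  have hprod : ∏ i, μ ((Equiv.arrowProdEquivProdArrow (Fin n) (fun _ => Ω)
      (fun _ => B)).symm (x, b) i) = (∏ i, w (x i)) * prodSpec (fun i => σ (x i)) b :=
    Finset.prod_mul_distrib
  have hW : 0 ≤ ∏ i, w (x i) := Finset.prod_nonneg fun i _ => hw0 _
  have hS := prodSpec_nonneg (fun i => σ (x i)) b
  rw [hprod]
  -- Zero eigenvalues carry no weight, and must be set aside because the logarithm of the product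
  -- does not split there.
  by_cases hz : prodSpec (fun i => σ (x i)) b = 0
  · simp [hz]
  have hsum : ∑ i, f ((Equiv.arrowProdEquivProdArrow (Fin n) (fun _ => Ω)
      (fun _ => B)).symm (x, b) i) = -Real.logb 2 (prodSpec (fun i => σ (x i)) b) := by
    rw [logb_prodSpec hz, ← Finset.sum_neg_distrib]
    rfl
  rw [hsum]
  by_cases hb : s (prodSpec (fun i => σ (x i)) b)
  · rw [if_pos hb, mul_zero]
    split_ifs
    exacts [mul_nonneg hW hS, le_rfl]
  · rw [if_neg hb, if_pos]
    by_contra hlt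
    exact hb (hs _ (lt_of_le_of_ne hS (Ne.symm hz)) (not_le.1 hlt))

/-- Random product states rarely fail the test for small eigenvalues. -/
theorem exists_lowTest_error_le {w : Ω → ℝ} (hw0 : ∀ a, 0 ≤ w a) (hw1 : ∑ a, w a = 1)
    (σ : Ω → DensityMatrix B) {ε δ : ℝ} (hε : 0 < ε) (hδ : 0 < δ) :
    ∃ N : ℕ, ∀ n ≥ N, ∑ x : Fin n → Ω, (∏ i, w (x i)) * expect (prodState fun i => σ (x i))
      (1 - lowTest (fun i => σ (x i))
        ((2 : ℝ) ^ (-((n : ℝ) * (∑ a, w a * (σ a).entropy - δ))))) ≤ ε := by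
  obtain ⟨N, hN⟩ := exists_sum_atypical_le hw0 hw1 σ hε hδ
  refine ⟨N, fun n hn => ?_⟩
  simp only [expect_one_sub_lowTest]
  refine hN n hn (fun t => t ≤ _) fun t ht h => ?_
  rw [← Real.logb_le_iff_le_rpow one_lt_two ht]
  have := (abs_lt.1 h).1
  linarith

/-- Random product states rarely fail the test for large eigenvalues. -/
theorem exists_highTest_error_le {w : Ω → ℝ} (hw0 : ∀ a, 0 ≤ w a) (hw1 : ∑ a, w a = 1)
    (σ : Ω → DensityMatrix B) {ε δ : ℝ} (hε : 0 < ε) (hδ : 0 < δ) :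
    ∃ N : ℕ, ∀ n ≥ N, ∑ x : Fin n → Ω, (∏ i, w (x i)) * expect (prodState fun i => σ (x i))
      (1 - highTest (fun i => σ (x i))
        ((2 : ℝ) ^ (-((n : ℝ) * (∑ a, w a * (σ a).entropy + δ))))) ≤ ε := by
  obtain ⟨N, hN⟩ := exists_sum_atypical_le hw0 hw1 σ hε hδ
  refine ⟨N, fun n hn => ?_⟩
  simp only [expect_one_sub_highTest]
  refine hN n hn (fun t => _ ≤ t) fun t ht h => ?_
  rw [← Real.le_logb_iff_rpow_le one_lt_two ht]
  have := (abs_lt.1 h).2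
  linarith

end Typicality

/-! ### Entropy and conditional mutual information of classical-quantum states. -/

section Entropy

open QMAC Polynomial

variable {ι κ α β γ : Type*} [Fintype ι] [DecidableEq ι] [Fintype κ] [DecidableEq κ]
  [Fintype α] [DecidableEq α] [Fintype β] [DecidableEq β] [Fintype γ] [DecidableEq γ]

theorem charpoly_spectralOp {V : Matrix κ κ ℂ} (hV : Vᴴ * V = 1) (d : κ → ℝ) :
    (spectralOp V d).charpoly = ∏ k, (X - C (d k : ℂ)) := by
  rw [spectralOp, Matrix.charpoly_mul_comm, ← mul_assoc, hV, one_mul, Matrix.charpoly_diagonal]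

/-- The entropy may be computed from any orthonormal eigenbasis, after a relabelling. -/
theorem entropy_of_spectralOp (σ : DensityMatrix ι) (e : ι ≃ κ) {V : Matrix κ κ ℂ}
    (hV : Vᴴ * V = 1) (d : κ → ℝ) (h : σ.mat.submatrix e.symm e.symm = spectralOp V d) :
    σ.entropy = -∑ k, d k * Real.logb 2 (d k) := by
  -- The characteristic polynomial determines the eigenvalues as a multiset, which is all that the
  -- entropy sees.
  have h1 : σ.mat.charpoly = ∏ k, (X - C (d k : ℂ)) := by
    rw [← charpoly_spectralOp hV, ← h]
    exact (Matrix.charpoly_reindex e σ.mat).symm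
  have h2 := σ.posSemidef.isHermitian.roots_charpoly_eq_eigenvalues
  rw [h1, Finset.prod_eq_multiset_prod,
    ← Function.comp_def (fun z : ℂ => X - C z) (fun k => (d k : ℂ)), ← Multiset.map_map,
    Polynomial.roots_multiset_prod_X_sub_C] at h2
  have h3 : (Finset.univ.val.map d) = Finset.univ.val.map σ.spec := by
    have := congrArg (Multiset.map Complex.re) h2
    simpa [Multiset.map_map, Function.comp_def, DensityMatrix.spec] using this
  have h4 := congrArg (fun s => (s.map fun t => t * Real.logb 2 t).sum) h3
  simp only [Multiset.map_map, Function.comp_def] at h4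
  rw [DensityMatrix.entropy_eq]
  exact congrArg Neg.neg h4.symm

theorem entropy_of_diagonal (σ : DensityMatrix ι) (w : ι → ℝ)
    (h : σ.mat = Matrix.diagonal fun i => (w i : ℂ)) :
    σ.entropy = -∑ i, w i * Real.logb 2 (w i) :=
  entropy_of_spectralOp σ (Equiv.refl ι) (V := 1) (by simp) w (by simp [spectralOp, h])

/-- The entropy of a classical-quantum state. -/
theorem entropy_of_blockDiagonal (σ : DensityMatrix ι) (e : ι ≃ β × α) (w : α → ℝ)
    (τ : α → DensityMatrix β)
    (h : σ.mat.submatrix e.symm e.symm = Matrix.blockDiagonal fun a => (w a : ℂ) • (τ a).mat) :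
    σ.entropy = -∑ a, w a * Real.logb 2 (w a) + ∑ a, w a * (τ a).entropy := by
  have hd : (Matrix.blockDiagonal fun a => (w a : ℂ) • (τ a).mat) =
      spectralOp (Matrix.blockDiagonal fun a => (τ a).basis) (fun k => w k.2 * (τ k.2).spec k.1) := by
    rw [spectralOp, Matrix.blockDiagonal_conjTranspose]
    have : Matrix.diagonal (fun k : β × α => ((w k.2 * (τ k.2).spec k.1 : ℝ) : ℂ)) =
        Matrix.blockDiagonal fun a => Matrix.diagonal fun b => ((w a * (τ a).spec b : ℝ) : ℂ) :=
      (Matrix.blockDiagonal_diagonal fun a b => ((w a * (τ a).spec b : ℝ) : ℂ)).symm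
    rw [this, ← Matrix.blockDiagonal_mul, ← Matrix.blockDiagonal_mul]
    congr 1
    funext a
    have := spectralOp_smul (V := (τ a).basis) (w a) (τ a).spec
    rw [← DensityMatrix.mat_eq] at this
    rw [Complex.coe_smul]
    exact this
  have hV : (Matrix.blockDiagonal fun a => (τ a).basis)ᴴ *
      (Matrix.blockDiagonal fun a => (τ a).basis) = 1 := by
    rw [Matrix.blockDiagonal_conjTranspose, ← Matrix.blockDiagonal_mul]
    simp only [DensityMatrix.basis_unitary]
    exact Matrix.blockDiagonal_one
  rw [entropy_of_spectralOp σ e hV _ (h.trans hd), Fintype.sum_prod_type_right,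
    ← Finset.sum_neg_distrib, ← Finset.sum_neg_distrib, ← Finset.sum_add_distrib]
  refine Finset.sum_congr rfl fun a _ => ?_
  rw [DensityMatrix.entropy_eq]
  have hb : ∀ b, w a * (τ a).spec b * Real.logb 2 (w a * (τ a).spec b) =
      w a * Real.logb 2 (w a) * (τ a).spec b +
        w a * ((τ a).spec b * Real.logb 2 ((τ a).spec b)) := by
    intro b
    -- The chain rule survives vanishing factors because `0 * logb 2 0 = 0`.
    rcases eq_or_ne (w a) 0 with h0 | h0
    · simp [h0]
    rcases eq_or_ne ((τ a).spec b) 0 with h1 | h1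
    · simp [h1]
    rw [Real.logb_mul h0 h1]
    ring
  simp only [hb, Finset.sum_add_distrib, ← Finset.mul_sum, DensityMatrix.spec_sum]
  ring

/-- For a tripartite state that is classical on the first and third factor, the conditional mutual
information is a difference of average entropies. -/
theorem condMutualInfo_of_classical (θ : DensityMatrix (α × β × γ)) (v : γ → ℝ)
    (u : γ → stdSimplex ℝ α) (τ : α → γ → DensityMatrix β)
    (h : ∀ a b c a' b' c', θ.mat (a, b, c) (a', b', c') =
      if a = a' ∧ c = c' then ((v c * u c a : ℝ) : ℂ) * (τ a c).mat b b' else 0) :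
    condMutualInfo θ = ∑ c, v c * (DensityMatrix.mix (u c) fun a => τ a c).entropy -
      ∑ c, v c * ∑ a, u c a * (τ a c).entropy := by
  have hBC : θ.traceFst.mat = Matrix.blockDiagonal fun c =>
      (v c : ℂ) • (DensityMatrix.mix (u c) fun a => τ a c).mat := by
    ext ⟨b, c⟩ ⟨b', c'⟩
    simp only [DensityMatrix.traceFst, DensityMatrix.traceSnd, DensityMatrix.reindex,
      Matrix.sum_apply, Matrix.submatrix_apply, Equiv.prodComm_symm, Equiv.prodComm_apply,
      Prod.swap_prod_mk, h, Matrix.blockDiagonal_apply, true_and]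
    split_ifs
    · simp [DensityMatrix.mix, Matrix.sum_apply, Finset.mul_sum, mul_assoc]
    · simp
  have hC : θ.traceFst.traceFst.mat = Matrix.diagonal fun c => (v c : ℂ) := by
    have : θ.traceFst.traceFst.mat =
        ∑ b, θ.traceFst.mat.submatrix (fun c => (b, c)) (fun c => (b, c)) := rfl
    rw [this, hBC]
    ext c c'
    simp only [Matrix.sum_apply, Matrix.submatrix_apply, Matrix.blockDiagonal_apply,
      Matrix.diagonal_apply]
    split_ifs
    · have ht := (DensityMatrix.mix (u c) fun a => τ a c).trace_eq_one
      simp only [Matrix.smul_apply, smul_eq_mul, ← Finset.mul_sum]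
      rw [Matrix.trace] at ht
      simp only [Matrix.diag] at ht
      rw [ht, mul_one]
    · simp
  have hAC : ((θ.reindex ⟨fun s => ((s.1, s.2.2), s.2.1), fun s => (s.1.1, s.2, s.1.2),
      fun _ => rfl, fun _ => rfl⟩ : DensityMatrix ((α × γ) × β)).traceSnd).mat =
      Matrix.diagonal fun s : α × γ => ((v s.2 * u s.2 s.1 : ℝ) : ℂ) := by
    ext ⟨a, c⟩ ⟨a', c'⟩
    simp only [DensityMatrix.traceSnd, DensityMatrix.reindex, Matrix.sum_apply,
      Matrix.submatrix_apply, Equiv.coe_fn_symm_mk, h, Matrix.diagonal_apply, Prod.mk.injEq]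
    split_ifs
    · have ht := (τ a c).trace_eq_one
      rw [Matrix.trace] at ht
      simp only [Matrix.diag] at ht
      rw [← Finset.mul_sum, ht, mul_one]
    · simp
  let e : α × β × γ ≃ β × (α × γ) := ⟨fun s => (s.2.1, s.1, s.2.2), fun s => (s.2.1, s.1, s.2.2),
      fun _ => rfl, fun _ => rfl⟩
  have hABC : θ.mat.submatrix e.symm e.symm =
      Matrix.blockDiagonal fun s : α × γ => ((v s.2 * u s.2 s.1 : ℝ) : ℂ) • (τ s.1 s.2).mat := by
    ext ⟨b, a, c⟩ ⟨b', a', c'⟩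
    simp only [e, Matrix.submatrix_apply, Equiv.coe_fn_symm_mk, h, Matrix.blockDiagonal_apply,
      Prod.mk.injEq, Matrix.smul_apply, smul_eq_mul]
  rw [condMutualInfo]
  -- The Shannon entropy of `AC` occurs in `H(AC)` and `H(ABC)`, that of `C` in `H(BC)` and `H(C)`;
  -- both cancel, leaving average output entropies.
  rw [entropy_of_diagonal _ _ hAC, entropy_of_diagonal _ _ hC,
    entropy_of_blockDiagonal θ e _ _ hABC,
    entropy_of_blockDiagonal θ.traceFst (Equiv.refl _) v _ hBC]
  have : ∑ c, v c * ∑ a, u c a * (τ a c).entropy =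
      ∑ s : α × γ, v s.2 * u s.2 s.1 * (τ s.1 s.2).entropy := by
    rw [Fintype.sum_prod_type_right]
    simp only [Finset.mul_sum, mul_assoc]
  rw [this]
  ring

end Entropy

/-! ### The three mutual informations of the channel state. -/

section ChannelInformation

open QMAC

variable {𝒬 X₁ X₂ B : Type*} [Fintype 𝒬] [Fintype X₁] [Fintype X₂] [Fintype B]
  [DecidableEq 𝒬] [DecidableEq X₁] [DecidableEq X₂] [DecidableEq B]
  (ρ : X₁ → X₂ → DensityMatrix B) (pQ : stdSimplex ℝ 𝒬)
  (p₁ : 𝒬 → stdSimplex ℝ X₁) (p₂ : 𝒬 → stdSimplex ℝ X₂)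

theorem codeState_apply (q q' : 𝒬) (x₁ x₁' : X₁) (x₂ x₂' : X₂) (b b' : B) :
    (codeState ρ pQ p₁ p₂).mat (q, x₁, x₂, b) (q', x₁', x₂', b') =
      if q = q' ∧ x₁ = x₁' ∧ x₂ = x₂' then
        ((pQ q * p₁ q x₁ * p₂ q x₂ : ℝ) : ℂ) * (ρ x₁ x₂).mat b b' else 0 := by
  simp only [codeState, Matrix.sum_apply, Matrix.smul_apply, Matrix.kroneckerMap_apply,
    smul_eq_mul, Matrix.single_apply]
  rw [Finset.sum_eq_single q, Finset.sum_eq_single x₁, Finset.sum_eq_single x₂]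
  · by_cases h : q = q' <;> by_cases h1 : x₁ = x₁' <;> by_cases h2 : x₂ = x₂' <;> simp [h, h1, h2]
  all_goals simp +contextual

/-- The product of two probability vectors. -/
def prodSimplex {α β : Type*} [Fintype α] [Fintype β] (u : stdSimplex ℝ α)
    (v : stdSimplex ℝ β) : stdSimplex ℝ (α × β) :=
  ⟨fun s => u s.1 * v s.2, fun s => mul_nonneg (u.2.1 s.1) (v.2.1 s.2), by
    have hu : ∑ a, u a = (1 : ℝ) := u.2.2
    have hv : ∑ b, v b = (1 : ℝ) := v.2.2
    rw [Fintype.sum_prod_type]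
    simp only [← Finset.mul_sum, hv, mul_one, hu]⟩

theorem prodSimplex_apply {α β : Type*} [Fintype α] [Fintype β] (u : stdSimplex ℝ α)
    (v : stdSimplex ℝ β) (s : α × β) : prodSimplex u v s = u s.1 * v s.2 := rfl

theorem infoFirst_eq : infoFirst (codeState ρ pQ p₁ p₂) =
    ∑ s : X₂ × 𝒬, pQ s.2 * p₂ s.2 s.1 * (DensityMatrix.mix (p₁ s.2) fun x => ρ x s.1).entropy -
      ∑ s : X₂ × 𝒬, pQ s.2 * p₂ s.2 s.1 * ∑ x, p₁ s.2 x * (ρ x s.1).entropy := by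
  refine condMutualInfo_of_classical _ (fun s : X₂ × 𝒬 => pQ s.2 * p₂ s.2 s.1)
    (fun s => p₁ s.2) (fun x s => ρ x s.1) fun a b c a' b' c' => ?_
  simp only [DensityMatrix.reindex, Matrix.submatrix_apply, Equiv.coe_fn_symm_mk, codeState_apply]
  refine if_congr ?_ ?_ rfl
  · rw [Prod.ext_iff]
    tauto
  · congr 2
    ring

theorem infoSecond_eq : infoSecond (codeState ρ pQ p₁ p₂) =
    ∑ s : X₁ × 𝒬, pQ s.2 * p₁ s.2 s.1 * (DensityMatrix.mix (p₂ s.2) (ρ s.1)).entropy -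
      ∑ s : X₁ × 𝒬, pQ s.2 * p₁ s.2 s.1 * ∑ y, p₂ s.2 y * (ρ s.1 y).entropy := by
  refine condMutualInfo_of_classical _ (fun s : X₁ × 𝒬 => pQ s.2 * p₁ s.2 s.1)
    (fun s => p₂ s.2) (fun y s => ρ s.1 y) fun a b c a' b' c' => ?_
  simp only [DensityMatrix.reindex, Matrix.submatrix_apply, Equiv.coe_fn_symm_mk, codeState_apply]
  refine if_congr ?_ rfl rfl
  rw [Prod.ext_iff]
  tauto

theorem infoSum_eq : infoSum (codeState ρ pQ p₁ p₂) =
    ∑ q, pQ q * (DensityMatrix.mix (prodSimplex (p₁ q) (p₂ q)) fun s => ρ s.1 s.2).entropy -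
      ∑ q, pQ q * ∑ s, prodSimplex (p₁ q) (p₂ q) s * (ρ s.1 s.2).entropy := by
  refine condMutualInfo_of_classical _ (fun q => pQ q)
    (fun q => prodSimplex (p₁ q) (p₂ q)) (fun s _ => ρ s.1 s.2) fun a b c a' b' c' => ?_
  simp only [DensityMatrix.reindex, Matrix.submatrix_apply, Equiv.coe_fn_symm_mk, codeState_apply]
  refine if_congr ?_ ?_ rfl
  · rw [Prod.ext_iff]
    tauto
  · rw [prodSimplex_apply, mul_assoc]

end ChannelInformation

/-! ### Decoding for a given time-sharing sequence, and bookkeeping for the limit. -/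

section Achievability

open QMAC
open scoped MatrixOrder Matrix.Norms.L2Operator

theorem sum_pi_prod {α β : Type*} [Fintype α] [Fintype β] {n : ℕ} (F : (Fin n → α × β) → ℝ) :
    ∑ z, F z = ∑ x : Fin n → α, ∑ y : Fin n → β, F fun i => (x i, y i) := by
  classical
  rw [← (Equiv.arrowProdEquivProdArrow (Fin n) (fun _ => α) (fun _ => β)).symm.sum_comp,
    Fintype.sum_prod_type]
  rfl

theorem sum_prod_simplex {α : Type*} [Fintype α] {n : ℕ} (w : Fin n → stdSimplex ℝ α) :
    ∑ x : Fin n → α, ∏ i, w i (x i) = 1 := by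
  classical
  have := (Finset.prod_univ_sum (fun _ : Fin n => Finset.univ) fun i a => w i a).symm
  rw [Fintype.piFinset_univ] at this
  rw [this]
  exact Finset.prod_eq_one fun i _ => (w i).2.2

/-- Reconciles the joint mixture in the sum-rate information with the iterated mixture that codebook
averaging produces. -/
theorem QMAC.DensityMatrix.mix_prodSimplex {α β B : Type*} [Fintype α] [Fintype β] [Fintype B]
    [DecidableEq B] (u : stdSimplex ℝ α) (v : stdSimplex ℝ β) (τ : α → β → DensityMatrix B) :
    (DensityMatrix.mix (prodSimplex u v) fun s => τ s.1 s.2) =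
      DensityMatrix.mix u fun a => DensityMatrix.mix v (τ a) := by
  have h : (DensityMatrix.mix (prodSimplex u v) fun s => τ s.1 s.2).mat =
      (DensityMatrix.mix u fun a => DensityMatrix.mix v (τ a)).mat := by
    simp only [DensityMatrix.mix, prodSimplex_apply, Fintype.sum_prod_type, Finset.smul_sum,
      smul_smul]
  generalize DensityMatrix.mix (prodSimplex u v) (fun s => τ s.1 s.2) = A at h
  generalize DensityMatrix.mix u (fun a => DensityMatrix.mix v (τ a)) = A' at h
  cases A
  cases A'
  congr

variable {𝒬 X₁ X₂ B : Type*} [Fintype 𝒬] [Fintype X₁] [Fintype X₂] [Fintype B] [DecidableEq B]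
  (ρ : X₁ → X₂ → DensityMatrix B) (p₁ : 𝒬 → stdSimplex ℝ X₁) (p₂ : 𝒬 → stdSimplex ℝ X₂)

/-- The output state averaged over the second input. -/
def avgSecond (s : 𝒬 × X₁) : DensityMatrix B := DensityMatrix.mix (p₂ s.1) (ρ s.2)

/-- The output state averaged over the first input. -/
def avgFirst (s : 𝒬 × X₂) : DensityMatrix B := DensityMatrix.mix (p₁ s.1) fun x => ρ x s.2

/-- The output state averaged over both inputs. -/
def avgBoth (q : 𝒬) : DensityMatrix B :=
  DensityMatrix.mix (p₁ q) fun x => DensityMatrix.mix (p₂ q) (ρ x)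

/-- The probability that a product state fails the test for small eigenvalues. -/
def lowError {n : ℕ} (σ : Fin n → DensityMatrix B) (L : ℝ) : ℝ :=
  expect (prodState σ) (1 - lowTest σ L)

/-- The probability that a product state fails the test for large eigenvalues. -/
def highError {n : ℕ} (σ : Fin n → DensityMatrix B) (L : ℝ) : ℝ :=
  expect (prodState σ) (1 - highTest σ L)

/-- The decoder for a fixed time-sharing sequence. -/
theorem exists_decoder_of_timeSharing {n M₁ M₂ : ℕ} [NeZero M₁] [NeZero M₂] (q : Fin n → 𝒬)
    {L₀ L₁ L₂ κ η : ℝ} (hL₀ : 0 ≤ L₀) (hL₁ : 0 ≤ L₁) (hL₂ : 0 ≤ L₂) (hκ : 0 < κ) (hη : 0 < η) :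
    ∃ Λ : (Fin M₁ → Fin n → X₁) → (Fin M₂ → Fin n → X₂) → POVM (Fin n → B) (Fin M₁ × Fin M₂),
      ∑ c₁, ∑ c₂, codebookProb p₁ q c₁ * codebookProb p₂ q c₂ * avgError ρ c₁ c₂ (Λ c₁ c₂) ≤
      48 * (lowError (fun i => avgBoth ρ p₁ p₂ (q i)) L₀ +
        (∑ x : Fin n → X₁, (∏ i, p₁ (q i) (x i)) *
          lowError (fun i => avgSecond ρ p₂ (q i, x i)) L₁) +
        (∑ y : Fin n → X₂, (∏ i, p₂ (q i) (y i)) *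
          lowError (fun i => avgFirst ρ p₁ (q i, y i)) L₂) +
        ∑ x : Fin n → X₁, ∑ y : Fin n → X₂, (∏ i, p₁ (q i) (x i)) * (∏ i, p₂ (q i) (y i)) *
          highError (fun i => ρ (x i) (y i)) κ) +
      8 * (((M₁ : ℝ) - 1) * (κ⁻¹ * L₂) + ((M₂ : ℝ) - 1) * (κ⁻¹ * L₁) +
        ((M₁ : ℝ) - 1) * ((M₂ : ℝ) - 1) * (κ⁻¹ * L₀)) + 8 * η := by
  let p : (Fin n → X₁) → ℝ := fun x => ∏ i, p₁ (q i) (x i)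
  let r : (Fin n → X₂) → ℝ := fun y => ∏ i, p₂ (q i) (y i)
  have hp0 : ∀ x, 0 ≤ p x := fun x => Finset.prod_nonneg fun i _ => (p₁ (q i)).2.1 _
  have hr0 : ∀ y, 0 ≤ r y := fun y => Finset.prod_nonneg fun i _ => (p₂ (q i)).2.1 _
  have hp1 : ∑ x, p x = 1 := sum_prod_simplex fun i => p₁ (q i)
  have hr1 : ∑ y, r y = 1 := sum_prod_simplex fun i => p₂ (q i)
  have a2 : ∀ x : Fin n → X₁, ∑ y, r y • prodState (fun i => ρ (x i) (y i)) =
      prodState fun i => avgSecond ρ p₂ (q i, x i) := fun x =>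
    sum_smul_prodState (fun i => p₂ (q i)) (fun i => ρ (x i))
  have a1 : ∀ y : Fin n → X₂, ∑ x, p x • prodState (fun i => ρ (x i) (y i)) =
      prodState fun i => avgFirst ρ p₁ (q i, y i) := fun y =>
    sum_smul_prodState (fun i => p₁ (q i)) (fun i x => ρ x (y i))
  have a0 : ∑ x, p x • prodState (fun i => avgSecond ρ p₂ (q i, x i)) =
      prodState fun i => avgBoth ρ p₁ p₂ (q i) :=
    sum_smul_prodState (fun i => p₁ (q i)) (fun i x => DensityMatrix.mix (p₂ (q i)) (ρ x))
  have a0' : ∑ x, ∑ y, (p x * r y) • prodState (fun i => ρ (x i) (y i)) =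
      prodState fun i => avgBoth ρ p₁ p₂ (q i) := by
    rw [← a0]
    refine Finset.sum_congr rfl fun x _ => ?_
    rw [← a2, Finset.smul_sum]
    simp only [smul_smul]
  obtain ⟨Λ, hΛ⟩ := exists_simultaneous_decoder (M₁ := M₁) (M₂ := M₂) (p := p) (r := r)
    (ρ := fun x y => prodState fun i => ρ (x i) (y i))
    (P₀ := lowTest (fun i => avgBoth ρ p₁ p₂ (q i)) L₀)
    (Q₁ := fun x => lowTest (fun i => avgSecond ρ p₂ (q i, x i)) L₁)
    (Q₂ := fun y => lowTest (fun i => avgFirst ρ p₁ (q i, y i)) L₂)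
    (T := fun x y => highTest (fun i => ρ (x i) (y i)) κ)
    (K := κ⁻¹) (L₀ := L₀) (L₁ := L₁) (L₂ := L₂) (η := η)
    hp0 hp1 hr0 hr1 (lowTest_isStarProjection _ _) (fun _ => lowTest_isStarProjection _ _)
    (fun _ => lowTest_isStarProjection _ _)
    (fun x y => (highTest_isStarProjection _ _).nonneg)
    (fun x y => (highTest_isStarProjection _ _).le_one)
    (fun x y => prodState_nonneg _) (fun x y => prodState_trace _)
    (inv_nonneg.2 hκ.le) (fun x y => highTest_le _ hκ) hL₀ hL₁ hL₂
    (by rw [a0']; exact lowTest_conj_le _ hL₀)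
    (fun x => by rw [a2]; exact lowTest_conj_le _ hL₁)
    (fun y => by rw [a1]; exact lowTest_conj_le _ hL₂)
    (fun y => by rw [a1]; exact lowTest_conj_le_self _ _) hη
  refine ⟨Λ, le_trans (le_of_eq rfl) (hΛ.trans (le_of_eq ?_))⟩
  congr 3
  -- A test ignoring one or both inputs sees only the state averaged over them, so each test is
  -- charged with the error on the state whose spectrum defines it.
  have split : ∀ E₀ : Matrix (Fin n → B) (Fin n → B) ℂ,
      ∀ E₁ : (Fin n → X₁) → Matrix (Fin n → B) (Fin n → B) ℂ,
      ∀ E₂ : (Fin n → X₂) → Matrix (Fin n → B) (Fin n → B) ℂ,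
      ∀ E₃ : (Fin n → X₁) → (Fin n → X₂) → Matrix (Fin n → B) (Fin n → B) ℂ,
      ∑ x, ∑ y, p x * r y * (expect (prodState fun i => ρ (x i) (y i)) E₀ +
        expect (prodState fun i => ρ (x i) (y i)) (E₁ x) +
        expect (prodState fun i => ρ (x i) (y i)) (E₂ y) +
        expect (prodState fun i => ρ (x i) (y i)) (E₃ x y)) =
      expect (prodState fun i => avgBoth ρ p₁ p₂ (q i)) E₀ +
      ∑ x, p x * expect (prodState fun i => avgSecond ρ p₂ (q i, x i)) (E₁ x) +
      ∑ y, r y * expect (prodState fun i => avgFirst ρ p₁ (q i, y i)) (E₂ y) +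
      ∑ x, ∑ y, p x * r y * expect (prodState fun i => ρ (x i) (y i)) (E₃ x y) := by
    intro E₀ E₁ E₂ E₃
    simp only [mul_add, Finset.sum_add_distrib]
    congr 1
    congr 1
    · congr 1
      · rw [← a0, ← expect_smul_sum]
        refine Finset.sum_congr rfl fun x _ => ?_
        rw [← a2, ← expect_smul_sum, Finset.mul_sum]
        simp only [mul_assoc]
      · refine Finset.sum_congr rfl fun x _ => ?_
        rw [← a2, ← expect_smul_sum, Finset.mul_sum]
        simp only [mul_assoc]
    · rw [Finset.sum_comm]
      refine Finset.sum_congr rfl fun y _ => ?_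
      rw [← a1, ← expect_smul_sum, Finset.mul_sum]
      refine Finset.sum_congr rfl fun x _ => by ring
  exact split _ _ _ _

theorem exists_lowError_le {Ω : Type*} [Fintype Ω] {w : Ω → ℝ} (hw0 : ∀ a, 0 ≤ w a)
    (hw1 : ∑ a, w a = 1) (σ : Ω → DensityMatrix B) {ε δ : ℝ} (hε : 0 < ε) (hδ : 0 < δ) :
    ∃ N : ℕ, ∀ n ≥ N, ∑ x : Fin n → Ω, (∏ i, w (x i)) * lowError (fun i => σ (x i))
      ((2 : ℝ) ^ (-((n : ℝ) * (∑ a, w a * (σ a).entropy - δ)))) ≤ ε :=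
  exists_lowTest_error_le hw0 hw1 σ hε hδ

theorem exists_highError_le {Ω : Type*} [Fintype Ω] {w : Ω → ℝ} (hw0 : ∀ a, 0 ≤ w a)
    (hw1 : ∑ a, w a = 1) (σ : Ω → DensityMatrix B) {ε δ : ℝ} (hε : 0 < ε) (hδ : 0 < δ) :
    ∃ N : ℕ, ∀ n ≥ N, ∑ x : Fin n → Ω, (∏ i, w (x i)) * highError (fun i => σ (x i))
      ((2 : ℝ) ^ (-((n : ℝ) * (∑ a, w a * (σ a).entropy + δ)))) ≤ ε :=
  exists_highTest_error_le hw0 hw1 σ hε hδ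

variable [DecidableEq 𝒬] [DecidableEq X₁] [DecidableEq X₂] (pQ : stdSimplex ℝ 𝒬)

/-- The average entropy of the output given both inputs. -/
def entropyGivenBoth : ℝ :=
  ∑ s : 𝒬 × X₁ × X₂, pQ s.1 * p₁ s.1 s.2.1 * p₂ s.1 s.2.2 * (ρ s.2.1 s.2.2).entropy

theorem infoFirst_eq_sub : infoFirst (codeState ρ pQ p₁ p₂) =
    ∑ s : 𝒬 × X₂, pQ s.1 * p₂ s.1 s.2 * (avgFirst ρ p₁ s).entropy -
      entropyGivenBoth ρ p₁ p₂ pQ := by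
  rw [infoFirst_eq, entropyGivenBoth]
  congr 1
  · exact (Equiv.prodComm X₂ 𝒬).sum_comp
      fun s => pQ s.1 * p₂ s.1 s.2 * (avgFirst ρ p₁ s).entropy
  · rw [Fintype.sum_prod_type_right, Fintype.sum_prod_type]
    refine Finset.sum_congr rfl fun q _ => ?_
    rw [Fintype.sum_prod_type_right]
    refine Finset.sum_congr rfl fun y _ => ?_
    rw [Finset.mul_sum]
    refine Finset.sum_congr rfl fun x _ => by ring

theorem infoSecond_eq_sub : infoSecond (codeState ρ pQ p₁ p₂) =
    ∑ s : 𝒬 × X₁, pQ s.1 * p₁ s.1 s.2 * (avgSecond ρ p₂ s).entropy -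
      entropyGivenBoth ρ p₁ p₂ pQ := by
  rw [infoSecond_eq, entropyGivenBoth]
  congr 1
  · exact (Equiv.prodComm X₁ 𝒬).sum_comp
      fun s => pQ s.1 * p₁ s.1 s.2 * (avgSecond ρ p₂ s).entropy
  · rw [Fintype.sum_prod_type_right, Fintype.sum_prod_type]
    refine Finset.sum_congr rfl fun q _ => ?_
    rw [Fintype.sum_prod_type]
    refine Finset.sum_congr rfl fun x _ => ?_
    rw [Finset.mul_sum]
    refine Finset.sum_congr rfl fun y _ => by ring

theorem infoSum_eq_sub : infoSum (codeState ρ pQ p₁ p₂) =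
    ∑ q, pQ q * (avgBoth ρ p₁ p₂ q).entropy - entropyGivenBoth ρ p₁ p₂ pQ := by
  rw [infoSum_eq, entropyGivenBoth]
  simp only [DensityMatrix.mix_prodSimplex]
  congr 1
  rw [Fintype.sum_prod_type]
  refine Finset.sum_congr rfl fun q _ => ?_
  rw [Finset.mul_sum]
  refine Finset.sum_congr rfl fun s _ => ?_
  rw [prodSimplex_apply]
  ring

theorem sum_weighted_errors {ι : Type*} [Fintype ι] {W : ι → ℝ} (hW : ∑ q, W q = 1)
    (a b c d : ι → ℝ) (t η : ℝ) :
    ∑ q, W q * (48 * (a q + b q + c q + d q) + 8 * t + 8 * η) =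
      48 * (∑ q, W q * a q + ∑ q, W q * b q + ∑ q, W q * c q + ∑ q, W q * d q) +
        8 * t + 8 * η := by
  have h : ∀ q, W q * (48 * (a q + b q + c q + d q) + 8 * t + 8 * η) =
      48 * (W q * a q + W q * b q + W q * c q + W q * d q) + W q * (8 * t + 8 * η) := by
    intro q
    ring
  simp only [h, Finset.sum_add_distrib, ← Finset.mul_sum, ← Finset.sum_mul, hW]
  ring

/-- Given `q` the letters are independent but not identically distributed; the pairs `(q i, x i)`
are i.i.d., as the law of large numbers needs. -/
theorem sum_timeSharing_mul_sum {X : Type*} [Fintype X] {n : ℕ} (p : 𝒬 → stdSimplex ℝ X)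
    (F : (Fin n → 𝒬 × X) → ℝ) :
    ∑ q : Fin n → 𝒬, (∏ i, pQ (q i)) * ∑ x : Fin n → X, (∏ i, p (q i) (x i)) *
      F (fun i => (q i, x i)) =
      ∑ z : Fin n → 𝒬 × X, (∏ i, pQ (z i).1 * p (z i).1 (z i).2) * F z := by
  rw [sum_pi_prod]
  simp only [Finset.mul_sum, Finset.prod_mul_distrib, mul_assoc]

theorem sum_timeSharing_mul_sum_sum {n : ℕ} (F : (Fin n → X₁ × X₂) → ℝ) :
    ∑ q : Fin n → 𝒬, (∏ i, pQ (q i)) * ∑ x : Fin n → X₁, ∑ y : Fin n → X₂,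
      (∏ i, p₁ (q i) (x i)) * (∏ i, p₂ (q i) (y i)) * F (fun i => (x i, y i)) =
      ∑ z : Fin n → 𝒬 × X₁ × X₂, (∏ i, pQ (z i).1 * p₁ (z i).1 (z i).2.1 *
        p₂ (z i).1 (z i).2.2) * F (fun i => (z i).2) := by
  simp only [sum_pi_prod, Finset.mul_sum, Finset.prod_mul_distrib, mul_assoc]

/-- Counting wrong messages, rather than all of them, absorbs the rounding; so rates below `δ`,
where the ceiling is 1, need no separate case. -/
theorem natCast_sub_one_le_of_le_ceil {M : ℕ} {x : ℝ} (hx : 0 ≤ x) (h : M ≤ ⌈x⌉₊) :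
    (M : ℝ) - 1 ≤ x := by
  have h1 : (M : ℝ) ≤ ⌈x⌉₊ := by exact_mod_cast h
  have h2 := Nat.ceil_lt_add_one hx
  linarith

theorem exists_two_rpow_neg_le {c ε : ℝ} (hc : 0 < c) (hε : 0 < ε) :
    ∃ N : ℕ, ∀ n ≥ N, (2 : ℝ) ^ (-((n : ℝ) * c)) ≤ ε := by
  have hlt : (2 : ℝ) ^ (-c) < 1 := Real.rpow_lt_one_of_one_lt_of_neg one_lt_two (neg_lt_zero.2 hc)
  have h0 : (0 : ℝ) ≤ (2 : ℝ) ^ (-c) := by positivity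
  obtain ⟨N, hN⟩ := exists_pow_lt_of_lt_one hε hlt
  refine ⟨N, fun n hn => ?_⟩
  have : (2 : ℝ) ^ (-((n : ℝ) * c)) = ((2 : ℝ) ^ (-c)) ^ n := by
    rw [← Real.rpow_mul_natCast zero_le_two]
    congr 1
    ring
  rw [this]
  exact (pow_le_pow_of_le_one h0 hlt.le hn).trans hN.le

end Achievability

end

/-! ### The coding theorem. -/

theorem mainTheorem2 {𝒬 X₁ X₂ B : Type*}
    [Fintype 𝒬] [Fintype X₁] [Fintype X₂] [Fintype B]
    [DecidableEq 𝒬] [DecidableEq X₁] [DecidableEq X₂] [DecidableEq B]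
    (ρ : X₁ → X₂ → QMAC.DensityMatrix B) (pQ : stdSimplex ℝ 𝒬)
    (p₁ : 𝒬 → stdSimplex ℝ X₁) (p₂ : 𝒬 → stdSimplex ℝ X₂)
    (R₁ R₂ : ℝ)
    (hR₁ : R₁ ≤ QMAC.infoFirst (QMAC.codeState ρ pQ p₁ p₂))
    (hR₂ : R₂ ≤ QMAC.infoSecond (QMAC.codeState ρ pQ p₁ p₂))
    (hR : R₁ + R₂ ≤ QMAC.infoSum (QMAC.codeState ρ pQ p₁ p₂)) :
    ∀ ε > (0 : ℝ), ∀ δ > (0 : ℝ), ∃ N : ℕ, ∀ n ≥ N, ∀ M₁ M₂ : ℕ,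
      1 ≤ M₁ → M₁ ≤ ⌈(2 : ℝ) ^ ((n : ℝ) * (R₁ - δ))⌉₊ →
      1 ≤ M₂ → M₂ ≤ ⌈(2 : ℝ) ^ ((n : ℝ) * (R₂ - δ))⌉₊ →
      ∃ Λ : (Fin n → 𝒬) → (Fin M₁ → Fin n → X₁) → (Fin M₂ → Fin n → X₂) →
          QMAC.POVM (Fin n → B) (Fin M₁ × Fin M₂),
        QMAC.expectedError ρ pQ p₁ p₂ Λ ≤ ε := by
  intro ε hε δ hδ
  have hQ1 : ∑ q, pQ q = (1 : ℝ) := pQ.2.2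
  have h11 : ∀ q, ∑ x, p₁ q x = (1 : ℝ) := fun q => (p₁ q).2.2
  have h21 : ∀ q, ∑ x, p₂ q x = (1 : ℝ) := fun q => (p₂ q).2.2
  have hQ0 : ∀ q, 0 ≤ pQ q := fun q => pQ.2.1 q
  have h10 : ∀ q x, 0 ≤ p₁ q x := fun q => (p₁ q).2.1
  have h20 : ∀ q x, 0 ≤ p₂ q x := fun q => (p₂ q).2.1
  have hδ4 : 0 < δ / 4 := by positivity
  -- Error budget: four tests give `48 * 4 * (ε / 768) = ε / 4`, three kinds of wrong pair give `8 *
  -- 3 * (ε / 48) = ε / 2`, and the regularizer gives `8 * (ε / 32) = ε / 4`.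
  have hε' : 0 < ε / 768 := by positivity
  obtain ⟨N₀, hN₀⟩ := exists_lowError_le hQ0 hQ1 (avgBoth ρ p₁ p₂) hε' hδ4
  obtain ⟨N₁, hN₁⟩ := exists_lowError_le (w := fun s : 𝒬 × X₁ => pQ s.1 * p₁ s.1 s.2)
    (fun s => mul_nonneg (hQ0 _) (h10 _ _))
    (by simp [Fintype.sum_prod_type, ← Finset.mul_sum, h11, hQ1]) (avgSecond ρ p₂) hε' hδ4
  obtain ⟨N₂, hN₂⟩ := exists_lowError_le (w := fun s : 𝒬 × X₂ => pQ s.1 * p₂ s.1 s.2)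
    (fun s => mul_nonneg (hQ0 _) (h20 _ _))
    (by simp [Fintype.sum_prod_type, ← Finset.mul_sum, h21, hQ1]) (avgFirst ρ p₁) hε' hδ4
  obtain ⟨N₃, hN₃⟩ := exists_highError_le
    (w := fun s : 𝒬 × X₁ × X₂ => pQ s.1 * p₁ s.1 s.2.1 * p₂ s.1 s.2.2)
    (fun s => mul_nonneg (mul_nonneg (hQ0 _) (h10 _ _)) (h20 _ _))
    (by simp [Fintype.sum_prod_type, ← Finset.mul_sum, h11, h21, hQ1])
    (fun s => ρ s.2.1 s.2.2) hε' hδ4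
  obtain ⟨N₄, hN₄⟩ := exists_two_rpow_neg_le (half_pos hδ) (show 0 < ε / 48 by positivity)
  refine ⟨N₀ + N₁ + N₂ + N₃ + N₄, fun n hn M₁ M₂ hM₁ hM₁' hM₂ hM₂' => ?_⟩
  specialize hN₀ n (by omega)
  specialize hN₁ n (by omega)
  specialize hN₂ n (by omega)
  specialize hN₃ n (by omega)
  specialize hN₄ n (by omega)
  set H₀ := ∑ q, pQ q * (avgBoth ρ p₁ p₂ q).entropy with hH₀
  set H₁ := ∑ s : 𝒬 × X₁, pQ s.1 * p₁ s.1 s.2 * (avgSecond ρ p₂ s).entropy with hH₁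
  set H₂ := ∑ s : 𝒬 × X₂, pQ s.1 * p₂ s.1 s.2 * (avgFirst ρ p₁ s).entropy with hH₂
  change ∑ x : Fin n → 𝒬 × X₁ × X₂, _ * highError _
    (2 ^ (-((n : ℝ) * (entropyGivenBoth ρ p₁ p₂ pQ + δ / 4)))) ≤ _ at hN₃
  rw [infoFirst_eq_sub, ← hH₂] at hR₁
  rw [infoSecond_eq_sub, ← hH₁] at hR₂
  rw [infoSum_eq_sub, ← hH₀] at hR
  set H₃ := entropyGivenBoth ρ p₁ p₂ pQ
  have : NeZero M₁ := ⟨by omega⟩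
  have : NeZero M₂ := ⟨by omega⟩
  set L₀ : ℝ := 2 ^ (-((n : ℝ) * (H₀ - δ / 4))) with hL₀
  set L₁ : ℝ := 2 ^ (-((n : ℝ) * (H₁ - δ / 4))) with hL₁
  set L₂ : ℝ := 2 ^ (-((n : ℝ) * (H₂ - δ / 4))) with hL₂
  set κ : ℝ := 2 ^ (-((n : ℝ) * (H₃ + δ / 4))) with hκ
  have hL₀0 : 0 ≤ L₀ := by positivity
  have hL₁0 : 0 ≤ L₁ := by positivity
  have hL₂0 : 0 ≤ L₂ := by positivity
  have hκ0 : 0 < κ := by positivity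
  choose Λ hΛ using fun q : Fin n → 𝒬 => exists_decoder_of_timeSharing (M₁ := M₁) (M₂ := M₂)
    ρ p₁ p₂ q hL₀0 hL₁0 hL₂0 hκ0 (show 0 < ε / 32 by positivity)
  refine ⟨Λ, ?_⟩
  have m₁ := natCast_sub_one_le_of_le_ceil (by positivity) hM₁'
  have m₂ := natCast_sub_one_le_of_le_ceil (by positivity) hM₂'
  have m₁0 : (0 : ℝ) ≤ M₁ - 1 := sub_nonneg.2 (by exact_mod_cast hM₁)
  have m₂0 : (0 : ℝ) ≤ M₂ - 1 := sub_nonneg.2 (by exact_mod_cast hM₂)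
  have hn0 : (0 : ℝ) ≤ n := n.cast_nonneg
  have hκi : κ⁻¹ = 2 ^ ((n : ℝ) * (H₃ + δ / 4)) := by
    rw [hκ, Real.rpow_neg zero_le_two, inv_inv]
  -- The rate is `δ` below the information and the two tests cost `δ / 4` each, so the exponent is
  -- at most `-n * (δ / 2)`.
  have b₂ : ((M₁ : ℝ) - 1) * (κ⁻¹ * L₂) ≤ ε / 48 := by
    refine (mul_le_mul_of_nonneg_right m₁ (by positivity)).trans (le_trans ?_ hN₄)
    rw [hκi, hL₂, ← Real.rpow_add two_pos, ← Real.rpow_add two_pos]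
    refine Real.rpow_le_rpow_of_exponent_le one_le_two ?_
    linarith [mul_le_mul_of_nonneg_left hR₁ hn0]
  have b₁ : ((M₂ : ℝ) - 1) * (κ⁻¹ * L₁) ≤ ε / 48 := by
    refine (mul_le_mul_of_nonneg_right m₂ (by positivity)).trans (le_trans ?_ hN₄)
    rw [hκi, hL₁, ← Real.rpow_add two_pos, ← Real.rpow_add two_pos]
    refine Real.rpow_le_rpow_of_exponent_le one_le_two ?_
    linarith [mul_le_mul_of_nonneg_left hR₂ hn0]
  -- Both rates back off by `δ` here, leaving `3δ / 2`, more than the needed `δ / 2`.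
  have b₀ : ((M₁ : ℝ) - 1) * ((M₂ : ℝ) - 1) * (κ⁻¹ * L₀) ≤ ε / 48 := by
    refine (mul_le_mul_of_nonneg_right (mul_le_mul m₁ m₂ m₂0 (by positivity))
      (by positivity)).trans (le_trans ?_ hN₄)
    rw [hκi, hL₀, ← Real.rpow_add two_pos, ← Real.rpow_add two_pos, ← Real.rpow_add two_pos]
    refine Real.rpow_le_rpow_of_exponent_le one_le_two ?_
    linarith [mul_le_mul_of_nonneg_left hR hn0, mul_nonneg hn0 hδ.le]
  have hW0 : ∀ q : Fin n → 𝒬, 0 ≤ ∏ i, pQ (q i) := fun q => Finset.prod_nonneg fun i _ => hQ0 _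
  have hW1 : ∑ q : Fin n → 𝒬, ∏ i, pQ (q i) = (1 : ℝ) := sum_prod_simplex fun _ => pQ
  rw [← sum_timeSharing_mul_sum] at hN₁ hN₂
  rw [← sum_timeSharing_mul_sum_sum p₁ p₂ pQ
    (fun z => highError (fun i => ρ (z i).1 (z i).2) κ)] at hN₃
  refine (Finset.sum_le_sum fun q _ => mul_le_mul_of_nonneg_left (hΛ q) (hW0 q)).trans ?_
  rw [sum_weighted_errors hW1]
  linarith
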